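/- **Model.** Let $V=\{1,\dots,n\}$, $p\in(0,1]$ and $S\subseteq V$ with $|S|=k$ ($S$ is chosen by an adversary). Every pair $\{u,v\}$ with $u\in S$, $v\in V\setminus S$ is put into a random set $E'$ independently with probability $p$; no other pair is in $E'$. Seeing $E'$, the adversary then picks an arbitrary graph $G=(V,E)$ with $E\supseteq E'$ in which $S$ is an independent set. **Algorithm** (deterministic; its input is $G$ only, not $S$, $k$ or $p$). Solve the semidefinite program (C-SDP) $$\text{minimize } \sum_{u,v\in V}\|x_u-x_v\|^2\quad\text{subject to}\quad \|x_u\|^2=1\ (u\in V),\quad \langle x_u,x_v\rangle\ge 0\ (u,v\in V),\quad \langle x_u,x_v\rangle=0\ (\{u,v\}\in E)$$ over vectors $x_u\in\mathbb R^n$. For every vertex $u$ form the candidate set $\{v:\|x_u-x_v\|<1\}$ and extend it greedily: go through the vertices in order and add each one that is not adjacent to any vertex already in the set. Return a largest one among the candidate sets that are independent in $G$ (the empty set if there is none). **Statement.** (i) The C-SDP of every graph has an optimal solution. (ii) Given the solution of the C-SDP, the rest of the algorithm takes a number of elementary steps (adjacency queries, arithmetic operations on and comparisons of coordinates, list operations)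 bounded by a polynomial in $n$. (iii) There is an absolute constant $c>0$ such that, whenever $$k\ \ge\ c\,\Big(\frac np\Big)^{2/3},$$ with high probability over $E'$ the following holds: for every choice of $G$ by the adversary and every optimal solution of the C-SDP of $G$, the algorithm returns an independent set of $G$ with at least $k$ vertices. Here "with high probability" means with probability tending to $1$ as $n\to\infty$, uniformly in $p$, $k$ and $S$: for every $\varepsilon>0$ there is $N$ such that for all $n\ge N$, all $p\in(0,1]$, all $k$ with $k\ge c(n/p)^{2/3}$ and all $S$ with $|S|=k$ the probability is at least $1-\varepsilon$. -/

import Mathlib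

noncomputable section

namespace SemiRandom

open MeasureTheory ProbabilityTheory

/-! ### The semi-random model -/

/-- The boundary of `S`: all unordered pairs with one endpoint in `S` and the other outside `S`. -/
def boundary {n : ℕ} (S : Finset (Fin n)) : Set (Sym2 (Fin n)) :=
  {e | ∃ u ∈ S, ∃ v ∉ S, e = s(u, v)}

/-- Law of the random edge set `E'`: every boundary pair of `S` belongs to `E'` independently with
probability `p`, and no other pair belongs to `E'`. -/
def boundaryLaw {n : ℕ} (S : Finset (Fin n)) (p : unitInterval) : Measure (Set (Sym2 (Fin n))) :=
  setBernoulli (boundary S) p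

/-- The graphs which the adversary may present once `E'` has been drawn: all the edges of `E'` are
present, `S` is independent, and everything else is arbitrary. -/
def Admissible {n : ℕ} (S : Finset (Fin n)) (E' : Set (Sym2 (Fin n)))
    (G : SimpleGraph (Fin n)) : Prop :=
  SimpleGraph.fromEdgeSet E' ≤ G ∧ G.IsIndepSet (S : Set (Fin n))

/-! ### The crude semidefinite program

One vector per vertex. As `n` vectors span a space of dimension at most `n`, it is no restriction
to take the vectors in `ℝⁿ`. -/

/-- Feasibility for the crude SDP of `G`. -/
structure IsFeasible {n : ℕ} (G : SimpleGraph (Fin n))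
    (x : Fin n → EuclideanSpace ℝ (Fin n)) : Prop where
  norm_sq_eq_one : ∀ u, ‖x u‖ ^ 2 = 1
  inner_nonneg : ∀ u v, 0 ≤ inner ℝ (x u) (x v)
  inner_eq_zero : ∀ u v, G.Adj u v → inner ℝ (x u) (x v) = 0

/-- The objective of the crude SDP, to be minimized. -/
def objective {n : ℕ} (x : Fin n → EuclideanSpace ℝ (Fin n)) : ℝ :=
  ∑ u, ∑ v, ‖x u - x v‖ ^ 2

/-- `x` is an optimal solution of the crude SDP of `G`. -/
def IsOptimal {n : ℕ} (G : SimpleGraph (Fin n))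
    (x : Fin n → EuclideanSpace ℝ (Fin n)) : Prop :=
  IsFeasible G x ∧ ∀ y, IsFeasible G y → objective x ≤ objective y

/-! ### Step counting -/

/-- A computation together with the number of elementary steps it takes. -/
structure Timed (α : Type) where
  val : α
  steps : ℕ

namespace Timed

/-- Sequential composition adds up the steps. -/
instance : Monad Timed where
  pure a := ⟨a, 0⟩
  bind m f := ⟨(f m.val).val, m.steps + (f m.val).steps⟩

/-- Spend `c` steps. -/
def tick (c : ℕ) : Timed Unit := ⟨(), c⟩

end Timed

open Timed

/-! ### The recovery algorithm

The input is a graph `G` and an optimal solution `x` of its crude SDP. Vertex sets are kept as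
lists without repetitions. The step count charges one step for every list cell that is visited or
written, for every comparison of two vertices or two lengths, for every query to the adjacency
relation and for every operation on coordinates of the vectors. -/

open Classical in
/-- Is `v` equal or adjacent to some member of the list? -/
def conflicts {n : ℕ} (G : SimpleGraph (Fin n)) (v : Fin n) : List (Fin n) → Timed Bool
  | [] => do
      tick 1
      return false
  | w :: l => do
      tick 3
      if v = w ∨ G.Adj v w then return true else conflicts G v l

open Classical in
/-- The sublist of those vertices whose vectors are at distance less than `1` from the vector
of `u`. One evaluation of a squared distance in `ℝⁿ` and its comparison with `1` take `n`
subtractions, `n` multiplications, `n` additions and one comparison. -/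
def ball {n : ℕ} (x : Fin n → EuclideanSpace ℝ (Fin n)) (u : Fin n) :
    List (Fin n) → Timed (List (Fin n))
  | [] => do
      tick 1
      return []
  | v :: l => do
      let r ← ball x u l
      tick (3 * n + 3)
      if dist (x u) (x v) < 1 then return v :: r else return r

/-- The greedy step: run through the given vertices and add to the current set every vertex which
is not in it and has no neighbour in it. -/
def extend {n : ℕ} (G : SimpleGraph (Fin n)) :
    List (Fin n) → List (Fin n) → Timed (List (Fin n))
  | [], cur => do
      tick 1
      return cur
  | v :: l, cur => do
      let b ← conflicts G v cur
      tick 2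
      if b then extend G l cur else extend G l (v :: cur)

/-- Are the members of the list pairwise distinct and nonadjacent? -/
def checkIndep {n : ℕ} (G : SimpleGraph (Fin n)) : List (Fin n) → Timed Bool
  | [] => do
      tick 1
      return true
  | v :: l => do
      let b ← conflicts G v l
      tick 1
      if b then return false else checkIndep G l

/-- The candidate set of the vertex `u`: the ball of radius `1` around its vector, extended by the
greedy step. -/
def candidate {n : ℕ} (G : SimpleGraph (Fin n)) (x : Fin n → EuclideanSpace ℝ (Fin n))
    (u : Fin n) : Timed (List (Fin n)) := do
  let B ← ball x u (List.finRange n)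
  extend G (List.finRange n) B

/-- Run through the given centres and keep the largest candidate set which is independent
in `G`; the first list is the list of centres, the second one is the best set found so far. -/
def best {n : ℕ} (G : SimpleGraph (Fin n)) (x : Fin n → EuclideanSpace ℝ (Fin n)) :
    List (Fin n) → List (Fin n) → Timed (List (Fin n))
  | [], cur => do
      tick 1
      return cur
  | u :: l, cur => do
      let C ← candidate G x u
      let ok ← checkIndep G C
      tick (C.length + cur.length + 2)
      if ok ∧ cur.length < C.length then best G x l C else best G x l cur

/-- The whole algorithm after the crude SDP has been solved: return the largest independent
candidate set over all the vertices. -/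
def recover {n : ℕ} (G : SimpleGraph (Fin n)) (x : Fin n → EuclideanSpace ℝ (Fin n)) :
    Timed (List (Fin n)) :=
  best G x (List.finRange n) []

/-- The vertex set returned by the algorithm. -/
def output {n : ℕ} (G : SimpleGraph (Fin n)) (x : Fin n → EuclideanSpace ℝ (Fin n)) :
    Finset (Fin n) :=
  (recover G x).val.toFinset

end SemiRandom

end

/-!
Collapsing the vectors of `S` to a single unit vector orthogonal to all the other vectors keeps a
solution feasible, so an optimal solution satisfies
`∑ u ∈ S, ∑ v ∈ S, ‖x u - x v‖ ^ 2 ≤ 4 * ∑ u ∈ S, ∑ v ∉ S, ⟪x u, x v⟫`. The vectors at the two ends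
of a random edge are orthogonal and every vertex outside `S` has about `p * k` random neighbours, so
the right-hand side is at most a constant times the pairing of the centred random adjacency matrix
with the deviations `x w - c` of the vectors of `S` from their mean `c`. With high probability that
matrix is small on all `2 ^ n` sign vectors; rounding with a random Gaussian direction carries this
over to unit vectors, at the cost of a factor `π / 2`. Cauchy-Schwarz then gives
`k ^ 2 * ∑ w ∈ S, ‖x w - c‖ ^ 2 = O(n ^ 2 / p)`, which is a small multiple of `p * k ^ 3`.

Hence some `x u`, `u ∈ S`, is close to `c`, and every `v ∉ S` has a random neighbour `w ∈ S` whose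
vector is close to `x u`. As `x v` is orthogonal to `x w`, it has distance at least `1` from `x u`.
So the ball around `x u` contains the vectors of `S` only, while the greedy extension admits all of
`S` and is blocked at every `v ∉ S` by such a neighbour `w`.
-/

namespace SemiRandom

open MeasureTheory ProbabilityTheory Finset Real

/-! ### Sums of squares of independent variables -/

section Concentration

lemma iIndepFun_curry {Ω α β 𝓧 : Type*} [MeasurableSpace Ω] [MeasurableSpace 𝓧] {μ : Measure Ω}
    {X : α × β → Ω → 𝓧} (hX : ∀ i, Measurable (X i)) (hindep : iIndepFun X μ) :
    iIndepFun (fun a ω b ↦ X (a, b) ω) μ := by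
  have := hindep.isProbabilityMeasure
  have (i : α × β) : IsProbabilityMeasure (μ.map (X i)) :=
    Measure.isProbabilityMeasure_map (hX i).aemeasurable
  have hrow (a : α) : iIndepFun (fun b ↦ X (a, b)) μ :=
    hindep.precomp (Prod.mk_right_injective a)
  rw [iIndepFun_iff_map_fun_eq_infinitePi_map (by fun_prop)]
  simp_rw [fun a ↦ (hrow a).map_fun_eq_infinitePi_map fun b ↦ hX (a, b)]
  rw [← Measure.infinitePi_map_curry (fun a b ↦ μ.map (X (a, b))),
    ← hindep.map_fun_eq_infinitePi_map hX, Measure.map_map (by fun_prop) (by fun_prop)]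
  rfl

/-- The sum discretises the representation of `exp (y ^ 2)` as a Gaussian mixture of the functions
`y ↦ cosh (t * y)`. -/
lemma exp_sq_div_le_sum_cosh {M y : ℝ} (hy : |y| ≤ 4 * M) :
    exp (y ^ 2 / 64) ≤
      ∑ j ∈ range (⌊M⌋₊ + 1), exp (1 - 2 * (j : ℝ) ^ 2) * (2 * cosh (j * y)) := by
  set j := ⌊|y| / 8⌋₊
  have hj_mem : j ∈ range (⌊M⌋₊ + 1) :=
    mem_range_succ_iff.2 (Nat.floor_le_floor (by linarith [abs_nonneg y]))
  have hj_le : (j : ℝ) ≤ |y| / 8 := Nat.floor_le (by positivity)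
  have hj_lt : |y| / 8 < j + 1 := Nat.lt_floor_add_one _
  have hexponent : y ^ 2 / 64 ≤ (1 - 2 * (j : ℝ) ^ 2) + j * |y| := by
    rw [← sq_abs y]
    nlinarith [abs_nonneg y, j.cast_nonneg (α := ℝ)]
  have hcosh : exp (j * |y|) ≤ 2 * cosh (j * y) := by
    have habs : cosh (j * y) = cosh (j * |y|) := by
      rw [← cosh_abs, abs_mul, Nat.abs_cast]
    rw [habs, cosh_eq]
    linarith [exp_pos (-(j * |y|))]
  calc exp (y ^ 2 / 64) ≤ exp (1 - 2 * (j : ℝ) ^ 2) * exp (j * |y|) := by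
        rwa [← exp_add, exp_le_exp]
    _ ≤ exp (1 - 2 * (j : ℝ) ^ 2) * (2 * cosh (j * y)) := by gcongr
    _ ≤ _ := single_le_sum
        (f := fun j : ℕ ↦ exp (1 - 2 * (j : ℝ) ^ 2) * (2 * cosh (j * y)))
        (fun j _ ↦ mul_nonneg (exp_pos _).le (by linarith [cosh_pos (j * y)])) hj_mem

lemma sum_exp_one_sub_sq_le (J : ℕ) : ∑ j ∈ range J, exp (1 - (j : ℝ) ^ 2) ≤ 6 := by
  have hterm (j : ℕ) : exp (1 - (j : ℝ) ^ 2) ≤ 3 * (1 / 2 : ℝ) ^ j := by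
    have hj : (j : ℝ) ≤ (j : ℝ) ^ 2 := by exact_mod_cast Nat.le_self_pow two_ne_zero j
    have hhalf : exp (-1) ≤ 1 / 2 := by
      rw [exp_neg, one_div]
      exact inv_anti₀ two_pos (by linarith [exp_one_gt_d9])
    calc exp (1 - (j : ℝ) ^ 2) ≤ exp (1 + j * (-1)) := exp_le_exp.2 (by linarith)
      _ = exp 1 * exp (-1) ^ j := by rw [exp_add, exp_nat_mul]
      _ ≤ 3 * (1 / 2 : ℝ) ^ j := by
        gcongr
        linarith [exp_one_lt_d9]
  calc ∑ j ∈ range J, exp (1 - (j : ℝ) ^ 2) ≤ ∑ j ∈ range J, 3 * (1 / 2 : ℝ) ^ j :=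
        sum_le_sum fun j _ ↦ hterm j
    _ ≤ 6 := by
        rw [← mul_sum]
        linarith [sum_geometric_two_le J]

/-- The Gaussian exponential `exp (y² / 64)`, cut off to `0` where `4 * M < |y|` so that its
expectation is controlled by exponential moments with exponents in `[-M, M]` alone. -/
noncomputable def truncExpSq (M : ℝ) : ℝ → ℝ :=
  {y : ℝ | |y| ≤ 4 * M}.indicator fun y ↦ exp (y ^ 2 / 64)

lemma measurable_truncExpSq (M : ℝ) : Measurable (truncExpSq M) :=
  Measurable.indicator (by fun_prop) (measurableSet_le (by fun_prop) (by fun_prop))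

lemma truncExpSq_nonneg (M y : ℝ) : 0 ≤ truncExpSq M y :=
  Set.indicator_nonneg (fun _ _ ↦ (exp_pos _).le) _

lemma truncExpSq_of_abs_le {M y : ℝ} (hy : |y| ≤ 4 * M) : truncExpSq M y = exp (y ^ 2 / 64) :=
  Set.indicator_of_mem (s := {y : ℝ | |y| ≤ 4 * M}) hy _

lemma truncExpSq_le (M y : ℝ) : truncExpSq M y ≤ exp ((4 * M) ^ 2 / 64) := by
  refine Set.indicator_apply_le' (fun hy : |y| ≤ 4 * M ↦ ?_) fun _ ↦ (exp_pos _).le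
  have := sq_le_sq' (by linarith [abs_le.1 hy]) (abs_le.1 hy).2
  gcongr

lemma truncExpSq_le_sum_cosh (M y : ℝ) :
    truncExpSq M y ≤
      ∑ j ∈ range (⌊M⌋₊ + 1), exp (1 - 2 * (j : ℝ) ^ 2) * (2 * cosh (j * y)) :=
  Set.indicator_apply_le' (fun hy : |y| ≤ 4 * M ↦ exp_sq_div_le_sum_cosh hy) fun _ ↦
    sum_nonneg fun j _ ↦ mul_nonneg (exp_pos _).le (by linarith [cosh_pos (j * y)])

variable {Ω : Type*} [MeasurableSpace Ω] {μ : Measure Ω}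

lemma integral_two_mul_cosh {Y : Ω → ℝ} {t : ℝ} (hpos : Integrable (fun ω ↦ exp (t * Y ω)) μ)
    (hneg : Integrable (fun ω ↦ exp (-t * Y ω)) μ) :
    Integrable (fun ω ↦ 2 * cosh (t * Y ω)) μ ∧
      ∫ ω, 2 * cosh (t * Y ω) ∂μ = mgf Y μ t + mgf Y μ (-t) := by
  have heq : (fun ω ↦ 2 * cosh (t * Y ω)) = fun ω ↦ exp (t * Y ω) + exp (-t * Y ω) := by
    funext ω
    rw [cosh_eq, neg_mul]
    ring
  rw [heq]
  exact ⟨hpos.add hneg, integral_add hpos hneg⟩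

lemma integral_truncExpSq_le {Y : Ω → ℝ} {M : ℝ} (hM : 0 ≤ M)
    (hint : ∀ t, |t| ≤ M → Integrable (fun ω ↦ exp (t * Y ω)) μ)
    (hmgf : ∀ t, |t| ≤ M → mgf Y μ t ≤ exp (t ^ 2)) :
    ∫ ω, truncExpSq M (Y ω) ∂μ ≤ 12 := by
  have habs {j : ℕ} (hj : j ∈ range (⌊M⌋₊ + 1)) : |(j : ℝ)| ≤ M ∧ |-(j : ℝ)| ≤ M := by
    rw [abs_neg, Nat.abs_cast, and_self]
    exact (Nat.le_floor_iff hM).1 (mem_range_succ_iff.1 hj)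
  have hcosh {j : ℕ} (hj : j ∈ range (⌊M⌋₊ + 1)) :=
    integral_two_mul_cosh (hint j (habs hj).1) (hint (-j) (habs hj).2)
  have hcosh_le {j : ℕ} (hj : j ∈ range (⌊M⌋₊ + 1)) :
      ∫ ω, 2 * cosh (j * Y ω) ∂μ ≤ 2 * exp ((j : ℝ) ^ 2) := by
    have hpos := hmgf j (habs hj).1
    have hneg := hmgf (-j) (habs hj).2
    rw [neg_sq] at hneg
    rw [(hcosh hj).2]
    linarith
  calc ∫ ω, truncExpSq M (Y ω) ∂μ
      ≤ ∫ ω, ∑ j ∈ range (⌊M⌋₊ + 1), exp (1 - 2 * (j : ℝ) ^ 2) * (2 * cosh (j * Y ω)) ∂μ :=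
        integral_mono_of_nonneg (.of_forall fun ω ↦ truncExpSq_nonneg M (Y ω))
          (integrable_finsetSum _ fun j hj ↦ (hcosh hj).1.const_mul _)
          (.of_forall fun ω ↦ truncExpSq_le_sum_cosh M (Y ω))
    _ = ∑ j ∈ range (⌊M⌋₊ + 1), exp (1 - 2 * (j : ℝ) ^ 2) * ∫ ω, 2 * cosh (j * Y ω) ∂μ := by
        rw [integral_finsetSum _ fun j hj ↦ (hcosh hj).1.const_mul _]
        simp only [integral_const_mul]
    _ ≤ ∑ j ∈ range (⌊M⌋₊ + 1), 2 * exp (1 - (j : ℝ) ^ 2) := by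
        refine sum_le_sum fun j hj ↦ ?_
        refine (mul_le_mul_of_nonneg_left (hcosh_le hj) (exp_pos _).le).trans_eq ?_
        rw [mul_left_comm, ← exp_add]
        ring_nf
    _ ≤ 12 := by
        rw [← mul_sum]
        linarith [sum_exp_one_sub_sq_le (⌊M⌋₊ + 1)]

variable {κ : Type*} [Fintype κ] {Y : κ → Ω → ℝ}

lemma measureReal_sum_sq_ge_le_of_mgf_le_exp_sq
    (hindep : iIndepFun Y μ) (hY : ∀ k, Measurable (Y k)) {M : ℝ} (hM : 0 ≤ M)
    (hint : ∀ k t, |t| ≤ M → Integrable (fun ω ↦ exp (t * Y k ω)) μ)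
    (hmgf : ∀ k t, |t| ≤ M → mgf (Y k) μ t ≤ exp (t ^ 2)) (r : ℝ) :
    μ.real {ω | (∀ k, |Y k ω| ≤ 4 * M) ∧ r ≤ ∑ k, Y k ω ^ 2} ≤
      12 ^ Fintype.card κ * exp (-(r / 64)) := by
  have := hindep.isProbabilityMeasure
  have hprod_nonneg (ω : Ω) : 0 ≤ ∏ k, truncExpSq M (Y k ω) :=
    prod_nonneg fun _ _ ↦ truncExpSq_nonneg _ _
  have hprod_meas : Measurable fun ω ↦ ∏ k, truncExpSq M (Y k ω) :=
    Finset.measurable_fun_prod _ fun k _ ↦ (measurable_truncExpSq M).comp (hY k)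
  have hprod_int : Integrable (fun ω ↦ ∏ k, truncExpSq M (Y k ω)) μ := by
    refine .of_bound hprod_meas.aestronglyMeasurable (∏ _k : κ, exp ((4 * M) ^ 2 / 64))
      (.of_forall fun ω ↦ ?_)
    rw [norm_of_nonneg (hprod_nonneg ω)]
    exact prod_le_prod (fun _ _ ↦ truncExpSq_nonneg _ _) fun _ _ ↦ truncExpSq_le _ _
  have hexpect : ∫ ω, ∏ k, truncExpSq M (Y k ω) ∂μ ≤ 12 ^ Fintype.card κ := by
    rw [hindep.integral_fun_prod_comp (fun k ↦ (hY k).aemeasurable)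
      fun k ↦ (measurable_truncExpSq M).aestronglyMeasurable]
    refine (prod_le_prod (fun k _ ↦ integral_nonneg fun ω ↦ truncExpSq_nonneg _ _)
      fun k _ ↦ integral_truncExpSq_le hM (hint k) (hmgf k)).trans_eq ?_
    rw [prod_const, card_univ]
  have hsub : {ω | (∀ k, |Y k ω| ≤ 4 * M) ∧ r ≤ ∑ k, Y k ω ^ 2} ⊆
      {ω | exp (r / 64) ≤ ∏ k, truncExpSq M (Y k ω)} := by
    rintro ω ⟨hω, hr⟩
    simp only [Set.mem_ofPred_eq, truncExpSq_of_abs_le (hω _), ← exp_sum, ← sum_div]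
    gcongr
  rw [exp_neg, ← div_eq_mul_inv, le_div_iff₀ (exp_pos _), mul_comm]
  calc exp (r / 64) * μ.real {ω | (∀ k, |Y k ω| ≤ 4 * M) ∧ r ≤ ∑ k, Y k ω ^ 2}
      ≤ exp (r / 64) * μ.real {ω | exp (r / 64) ≤ ∏ k, truncExpSq M (Y k ω)} :=
        mul_le_mul_of_nonneg_left (measureReal_mono hsub) (exp_pos _).le
    _ ≤ ∫ ω, ∏ k, truncExpSq M (Y k ω) ∂μ :=
        mul_meas_ge_le_integral_of_nonneg (.of_forall hprod_nonneg) hprod_int _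
    _ ≤ 12 ^ Fintype.card κ := hexpect

lemma measureReal_sum_sq_ge_le (hindep : iIndepFun Y μ) (hY : ∀ k, Measurable (Y k))
    {M σ : ℝ} (hM : 0 ≤ M) (hσ : 0 < σ)
    (hint : ∀ k t, |t| ≤ M → Integrable (fun ω ↦ exp (t * Y k ω)) μ)
    (hmgf : ∀ k t, |t| ≤ M → mgf (Y k) μ t ≤ exp (t ^ 2 * σ)) (r : ℝ) :
    μ.real {ω | (∀ k, |Y k ω| ≤ 4 * (M * σ)) ∧ r ≤ ∑ k, Y k ω ^ 2} ≤
      12 ^ Fintype.card κ * exp (-(r / σ / 64)) := by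
  set τ := √σ
  have hτ : 0 < τ := sqrt_pos.2 hσ
  have hτ_sq : σ = τ ^ 2 := (sq_sqrt hσ.le).symm
  have habs {t : ℝ} (ht : |t| ≤ M * τ) : |t / τ| ≤ M := by
    rwa [abs_div, abs_of_pos hτ, div_le_iff₀ hτ]
  have hexp (k : κ) (t : ℝ) : (fun ω ↦ exp (t * (Y k ω / τ))) = fun ω ↦ exp (t / τ * Y k ω) := by
    simp only [mul_div_left_comm, mul_comm]
  have hbound := measureReal_sum_sq_ge_le_of_mgf_le_exp_sq
    (hindep.comp (fun _ y ↦ y / τ) fun _ ↦ by fun_prop) (fun k ↦ (hY k).div_const τ)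
    (M := M * τ) (by positivity) (fun k t ht ↦ ?_) (fun k t ht ↦ ?_) (r / σ)
  · have := hindep.isProbabilityMeasure
    refine le_trans (measureReal_mono ?_) hbound
    rintro ω ⟨hω, hr⟩
    refine ⟨fun k ↦ ?_, ?_⟩
    · simp only [Function.comp_apply]
      rw [abs_div, abs_of_pos hτ, div_le_iff₀ hτ, mul_assoc, mul_assoc, ← sq, ← hτ_sq]
      exact hω k
    · simp only [Function.comp_apply, div_pow, ← sum_div, ← hτ_sq]
      gcongr
  · exact hexp k t ▸ hint k _ (habs ht)
  · calc mgf (fun ω ↦ Y k ω / τ) μ t = mgf (Y k) μ (t / τ) := by simp only [mgf, hexp]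
      _ ≤ exp ((t / τ) ^ 2 * σ) := hmgf k _ (habs ht)
      _ = exp (t ^ 2) := by rw [hτ_sq]; field_simp

end Concentration

/-! ### Bernoulli random sets -/

section RandomSet

variable {ι : Type*} {u : Set ι} {p : unitInterval}

lemma map_mem_setBernoulli (u : Set ι) (p : unitInterval) :
    (setBernoulli u p).map (fun E i ↦ i ∈ E) = Measure.infinitePi fun i ↦
      unitInterval.toNNReal p • Measure.dirac (i ∈ u) +
        unitInterval.toNNReal (unitInterval.symm p) • Measure.dirac False := by
  have hmk : Measurable fun P : ι → Prop ↦ {i | P i} := MeasurableEquiv.setOfPred.measurable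
  rw [setBernoulli_eq_map, Measure.map_map (measurable_pi_lambda _ measurable_set_mem) hmk]
  exact Measure.map_id

lemma map_mem_apply_setBernoulli (u : Set ι) (p : unitInterval) (i : ι) :
    (setBernoulli u p).map (fun E ↦ i ∈ E) =
      unitInterval.toNNReal p • Measure.dirac (i ∈ u) +
        unitInterval.toNNReal (unitInterval.symm p) • Measure.dirac False := by
  have heval := congrArg (Measure.map fun P : ι → Prop ↦ P i) (map_mem_setBernoulli u p)
  rwa [Measure.map_map (measurable_pi_apply i) (measurable_pi_lambda _ measurable_set_mem),
    Measure.infinitePi_map_eval] at heval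

lemma iIndepFun_mem_setBernoulli (u : Set ι) (p : unitInterval) :
    iIndepFun (fun i (E : Set ι) ↦ i ∈ E) (setBernoulli u p) := by
  rw [iIndepFun_iff_map_fun_eq_infinitePi_map measurable_set_mem, map_mem_setBernoulli]
  simp_rw [map_mem_apply_setBernoulli]

lemma integral_comp_mem_setBernoulli {i : ι} (hi : i ∈ u) (f : Prop → ℝ) :
    ∫ E, f (i ∈ E) ∂setBernoulli u p = p * f True + (1 - p) * f False := by
  rw [← integral_map (measurable_set_mem i).aemeasurable (.of_discrete),
    map_mem_apply_setBernoulli, integral_add_measure .of_finite .of_finite,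
    integral_smul_nnreal_measure, integral_smul_nnreal_measure]
  simp [hi, NNReal.smul_def]

open Classical in
/-- The indicator of the event that `i` belongs to the random set `E`, as a real number. -/
noncomputable def memInd (E : Set ι) (i : ι) : ℝ := if i ∈ E then 1 else 0

lemma memInd_nonneg (E : Set ι) (i : ι) : 0 ≤ memInd E i := by
  unfold memInd
  positivity

lemma measurable_memInd (i : ι) : Measurable fun E : Set ι ↦ memInd E i :=
  .ite (measurableSet_mem i) measurable_const measurable_const

open Classical in
lemma iIndepFun_memInd (u : Set ι) (p : unitInterval) :
    iIndepFun (fun i E ↦ memInd E i) (setBernoulli u p) :=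
  (iIndepFun_mem_setBernoulli u p).comp (fun _ P ↦ if P then 1 else 0) fun _ ↦ .of_discrete

lemma integral_comp_memInd {i : ι} (hi : i ∈ u) (f : ℝ → ℝ) :
    ∫ E, f (memInd E i) ∂setBernoulli u p = p * f 1 + (1 - p) * f 0 := by
  classical
  simpa [memInd] using integral_comp_mem_setBernoulli (p := p) hi fun P ↦ f (if P then 1 else 0)

variable {κ : Type*} {e : κ → ι}

lemma mgf_sum_comp_memInd (he : e.Injective) {F : Finset κ} (hF : ∀ k ∈ F, e k ∈ u)
    {g : κ → ℝ → ℝ} (hg : ∀ k, Measurable (g k)) (t : ℝ) :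
    mgf (fun E ↦ ∑ k ∈ F, g k (memInd E (e k))) (setBernoulli u p) t =
      ∏ k ∈ F, (p * exp (t * g k 1) + (1 - p) * exp (t * g k 0)) := by
  have hindep : iIndepFun (fun k E ↦ g k (memInd E (e k))) (setBernoulli u p) :=
    ((iIndepFun_memInd u p).precomp he).comp g hg
  have hsum : (fun E ↦ ∑ k ∈ F, g k (memInd E (e k))) =
      ∑ k ∈ F, fun E ↦ g k (memInd E (e k)) := by
    ext E
    rw [Finset.sum_apply]
  rw [hsum, hindep.mgf_sum fun k ↦ (hg k).comp (measurable_memInd (e k))]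
  exact prod_congr rfl fun k hk ↦ integral_comp_memInd (hF k hk) fun a ↦ exp (t * g k a)

lemma integrable_exp_mul_sum_comp_memInd (he : e.Injective) {F : Finset κ}
    (hF : ∀ k ∈ F, e k ∈ u) {g : κ → ℝ → ℝ} (hg : ∀ k, Measurable (g k)) (t : ℝ) :
    Integrable (fun E ↦ exp (t * ∑ k ∈ F, g k (memInd E (e k)))) (setBernoulli u p) := by
  refine .of_integral_ne_zero (ne_of_gt ?_)
  change 0 < mgf (fun E ↦ ∑ k ∈ F, g k (memInd E (e k))) (setBernoulli u p) t
  rw [mgf_sum_comp_memInd he hF hg]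
  exact prod_pos fun k _ ↦ convex_Ioi (0 : ℝ) (exp_pos _) (exp_pos _) p.2.1
    (sub_nonneg.2 p.2.2) (by ring)

lemma mgf_sum_memInd_le (he : e.Injective) {F : Finset κ} (hF : ∀ k ∈ F, e k ∈ u) (t : ℝ) :
    mgf (fun E ↦ ∑ k ∈ F, memInd E (e k)) (setBernoulli u p) t ≤
      exp (p * #F * (exp t - 1)) := by
  rw [mgf_sum_comp_memInd he hF (g := fun _ a ↦ a) fun _ ↦ measurable_id, prod_const]
  have hbase : p * exp (t * 1) + (1 - p) * exp (t * 0) ≤ exp (p * (exp t - 1)) := by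
    rw [mul_one, mul_zero, exp_zero]
    linarith [add_one_le_exp (p * (exp t - 1))]
  have hnonneg : 0 ≤ p * exp (t * 1) + (1 - p) * exp (t * 0) :=
    convex_Ici (0 : ℝ) (exp_pos _).le (exp_pos _).le p.2.1 (sub_nonneg.2 p.2.2) (by ring)
  refine (pow_le_pow_left₀ hnonneg hbase _).trans_eq ?_
  rw [← exp_nat_mul]
  ring_nf

lemma measureReal_sum_memInd_le_le (he : e.Injective) {F : Finset κ} (hF : ∀ k ∈ F, e k ∈ u) :
    (setBernoulli u p).real {E | ∑ k ∈ F, memInd E (e k) ≤ p * #F / 2} ≤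
      exp (-(p * #F / 10)) := by
  have hexp : exp (-1) ≤ 2 / 5 := by
    rw [exp_neg, inv_le_comm₀ (exp_pos _) (by norm_num)]
    linarith [exp_one_gt_d9]
  have hpF : 0 ≤ p * (#F : ℝ) := mul_nonneg p.2.1 (Nat.cast_nonneg _)
  calc _ ≤ exp (-(-1) * (p * #F / 2)) *
          mgf (fun E ↦ ∑ k ∈ F, memInd E (e k)) (setBernoulli u p) (-1) :=
        measure_le_le_exp_mul_mgf _ (by norm_num) <|
          integrable_exp_mul_sum_comp_memInd he hF (g := fun _ a ↦ a) (fun _ ↦ measurable_id) _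
    _ ≤ exp (-(-1) * (p * #F / 2)) * exp (p * #F * (exp (-1) - 1)) := by
        gcongr
        exact mgf_sum_memInd_le he hF _
    _ ≤ exp (-(p * #F / 10)) := by
        rw [← exp_add, exp_le_exp]
        nlinarith

lemma measureReal_le_sum_memInd_le (he : e.Injective) {F : Finset κ} (hF : ∀ k ∈ F, e k ∈ u)
    {m : ℝ} (hm : #F ≤ m) :
    (setBernoulli u p).real {E | 3 * (p * m) ≤ ∑ k ∈ F, memInd E (e k)} ≤ exp (-(p * m)) := by
  have hpF : p * (#F : ℝ) ≤ p * m := mul_le_mul_of_nonneg_left hm p.2.1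
  have hpF0 : 0 ≤ p * (#F : ℝ) := mul_nonneg p.2.1 (Nat.cast_nonneg _)
  calc _ ≤ exp (-1 * (3 * (p * m))) *
          mgf (fun E ↦ ∑ k ∈ F, memInd E (e k)) (setBernoulli u p) 1 :=
        measure_ge_le_exp_mul_mgf _ zero_le_one <|
          integrable_exp_mul_sum_comp_memInd he hF (g := fun _ a ↦ a) (fun _ ↦ measurable_id) _
    _ ≤ exp (-1 * (3 * (p * m))) * exp (p * #F * (exp 1 - 1)) := by
        gcongr
        exact mgf_sum_memInd_le he hF _
    _ ≤ exp (-(p * m)) := by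
        rw [← exp_add, exp_le_exp]
        nlinarith [exp_one_lt_d9]

lemma exp_le_one_add_self_add_sq {x : ℝ} (hx : |x| ≤ 1) : exp x ≤ 1 + x + x ^ 2 := by
  linarith [(abs_le.1 (abs_exp_sub_one_sub_id_le hx)).2]

/-- The moment generating function of `1 - X / p` for a Bernoulli variable `X` with
parameter `p`. -/
lemma mgf_one_sub_bernoulli_div_le {p t : ℝ} (hp : 0 < p) (hp1 : p ≤ 1) (ht : |t| ≤ p) :
    p * exp (t * (1 - 1 / p)) + (1 - p) * exp (t * (1 - 0 / p)) ≤ exp (t ^ 2 / p) := by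
  have habs_one : |t * (1 - 1 / p)| ≤ 1 := by
    have hfactor : t * (1 - 1 / p) = -(t / p) * (1 - p) := by
      field_simp
      ring
    rw [hfactor, abs_mul, abs_neg, abs_div, abs_of_pos hp, abs_of_nonneg (sub_nonneg.2 hp1)]
    exact mul_le_one₀ ((div_le_one hp).2 ht) (sub_nonneg.2 hp1) (by linarith)
  have habs_zero : |t * (1 - 0 / p)| ≤ 1 := by simpa using ht.trans hp1
  calc _ ≤ p * (1 + t * (1 - 1 / p) + (t * (1 - 1 / p)) ^ 2) +
        (1 - p) * (1 + t * (1 - 0 / p) + (t * (1 - 0 / p)) ^ 2) :=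
        add_le_add (mul_le_mul_of_nonneg_left (exp_le_one_add_self_add_sq habs_one) hp.le)
          (mul_le_mul_of_nonneg_left (exp_le_one_add_self_add_sq habs_zero) (sub_nonneg.2 hp1))
    _ = t ^ 2 / p - t ^ 2 + 1 := by
        field_simp
        ring
    _ ≤ t ^ 2 / p + 1 := by linarith [sq_nonneg t]
    _ ≤ exp (t ^ 2 / p) := add_one_le_exp _

lemma mgf_sum_one_sub_memInd_div_mul_le (hp : 0 < p) (he : e.Injective) {F : Finset κ}
    (hF : ∀ k ∈ F, e k ∈ u) {a : κ → ℝ} (ha : ∀ k, |a k| ≤ 1) {t : ℝ} (ht : |t| ≤ p) :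
    mgf (fun E ↦ ∑ k ∈ F, (1 - memInd E (e k) / p) * a k) (setBernoulli u p) t ≤
      exp (t ^ 2 * (#F / p)) := by
  have hp' : (0 : ℝ) < p := hp
  have hmul (k : κ) : |t * a k| ≤ |t| := by
    rw [abs_mul]
    exact mul_le_of_le_one_right (abs_nonneg t) (ha k)
  rw [mgf_sum_comp_memInd he hF (g := fun k b ↦ (1 - b / p) * a k) (by fun_prop)]
  calc _ ≤ ∏ _k ∈ F, exp (t ^ 2 / p) := by
        refine prod_le_prod (fun k _ ↦ convex_Ici (0 : ℝ) (exp_pos _).le (exp_pos _).le p.2.1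
          (sub_nonneg.2 p.2.2) (by ring)) fun k _ ↦ ?_
        have hbernoulli := mgf_one_sub_bernoulli_div_le hp' p.2.2 ((hmul k).trans ht)
        simp only [mul_right_comm t (a k), ← mul_assoc] at hbernoulli ⊢
        refine hbernoulli.trans (exp_le_exp.2 ?_)
        exact div_le_div_of_nonneg_right (sq_le_sq.2 (hmul k)) hp'.le
    _ = exp (t ^ 2 * (#F / p)) := by
        rw [prod_const, ← exp_nat_mul]
        ring_nf

end RandomSet

/-! ### Rounding vectors to signs -/

section Rounding

lemma abs_cast_intUnit (ε : ℤˣ) : |((ε : ℤ) : ℝ)| = 1 := by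
  obtain rfl | rfl := Int.units_eq_one_or ε <;> simp

/-- The sign of a real number as an element of `{1, -1}`, with the convention that the sign
of `0` is `1`. -/
noncomputable def unitSign (t : ℝ) : ℤˣ := if 0 ≤ t then 1 else -1

lemma measurable_unitSign : Measurable fun t : ℝ ↦ ((unitSign t : ℤ) : ℝ) := by
  have heq : (fun t : ℝ ↦ ((unitSign t : ℤ) : ℝ)) = fun t ↦ if 0 ≤ t then 1 else -1 := by
    ext t
    rw [unitSign]
    split_ifs <;> simp
  rw [heq]
  exact .ite measurableSet_Ici measurable_const measurable_const

lemma unitSign_mul_self (t : ℝ) : ((unitSign t : ℤ) : ℝ) * t = |t| := by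
  obtain ht | ht := le_or_gt 0 t
  · simp [unitSign, ht, abs_of_nonneg ht]
  · simp [unitSign, ht.not_ge, abs_of_neg ht]

lemma integral_abs_gaussianReal : ∫ y, |y| ∂gaussianReal 0 1 = √(2 / π) := by
  have hhalf : ∫ y in Set.Ioi (0 : ℝ), y * exp (-y ^ 2 / 2) = 1 := by
    have := integral_rpow_mul_exp_neg_mul_rpow (p := 2) (q := 1) (b := 1 / 2)
      two_pos (by norm_num) (by norm_num)
    norm_num at this
    convert this using 5
    ring
  have habs : ∫ y : ℝ, |y| * exp (-y ^ 2 / 2) = 2 := by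
    have := integral_comp_abs (f := fun y : ℝ ↦ y * exp (-y ^ 2 / 2))
    simpa only [sq_abs, hhalf, mul_one] using this
  rw [integral_gaussianReal_eq_integral_smul one_ne_zero]
  have hdensity (y : ℝ) :
      gaussianPDFReal 0 1 y • |y| = (√(2 * π))⁻¹ * (|y| * exp (-y ^ 2 / 2)) := by
    simp [gaussianPDFReal]
    ring
  simp_rw [hdensity]
  rw [integral_const_mul, habs, sqrt_div zero_le_two, sqrt_mul zero_le_two]
  field_simp
  norm_num

variable {E : Type*} [NormedAddCommGroup E] [InnerProductSpace ℝ E] [FiniteDimensional ℝ E]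
  [MeasurableSpace E] [BorelSpace E]

lemma memLp_inner_stdGaussian (u : E) : MemLp (fun g ↦ inner ℝ u g) 2 (stdGaussian E) :=
  IsGaussian.memLp_dual _ (innerSL ℝ u) 2 (by norm_num)

lemma integral_inner_stdGaussian (u : E) : ∫ g, inner ℝ u g ∂stdGaussian E = 0 :=
  integral_strongDual_stdGaussian (innerSL ℝ u)

lemma integral_inner_sq_stdGaussian (u : E) :
    ∫ g, inner ℝ u g ^ 2 ∂stdGaussian E = ‖u‖ ^ 2 := by
  have hvar := variance_dual_stdGaussian (innerSL ℝ u)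
  rwa [innerSL_apply_norm, variance_of_integral_eq_zero
    (innerSL ℝ u).continuous.aemeasurable (integral_inner_stdGaussian u)] at hvar

lemma integral_abs_inner_stdGaussian {x : E} (hx : ‖x‖ = 1) :
    ∫ g, |inner ℝ x g| ∂stdGaussian E = √(2 / π) := by
  have hmap : (stdGaussian E).map (innerSL ℝ x) = gaussianReal 0 1 := by
    rw [IsGaussian.map_eq_gaussianReal, integral_strongDual_stdGaussian, variance_dual_stdGaussian,
      innerSL_apply_norm, hx, one_pow, Real.toNNReal_one]
  rw [← integral_abs_gaussianReal, ← hmap, integral_map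
    (innerSL ℝ x).continuous.aemeasurable continuous_abs.aestronglyMeasurable]
  rfl

lemma integrable_unitSign_mul_inner (x u : E) :
    Integrable (fun g ↦ ((unitSign (inner ℝ x g) : ℤ) : ℝ) * inner ℝ u g) (stdGaussian E) :=
  ((memLp_inner_stdGaussian u).integrable one_le_two).bdd_mul (c := 1)
    (measurable_unitSign.comp (innerSL ℝ x).continuous.measurable).aestronglyMeasurable
    (.of_forall fun _ ↦ (abs_cast_intUnit _).le)

/-- The reflection in the line through `x` preserves the measure and the sign and flips
`inner ℝ u g`. -/
lemma integral_unitSign_mul_inner_of_inner_eq_zero {x u : E} (hxu : inner ℝ x u = 0) :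
    ∫ g, ((unitSign (inner ℝ x g) : ℤ) : ℝ) * inner ℝ u g ∂stdGaussian E = 0 := by
  set R := (ℝ ∙ x).reflection
  have hRx (g : E) : inner ℝ x (R g) = inner ℝ x g := by
    rw [← R.inner_map_map x g,
      Submodule.reflection_mem_subspace_eq_self (Submodule.mem_span_singleton_self x)]
  have hRu (g : E) : inner ℝ u (R g) = -inner ℝ u g := by
    rw [← R.inner_map_map u g, Submodule.reflection_mem_subspace_orthogonalComplement_eq_neg
      (Submodule.mem_orthogonal_singleton_iff_inner_right.2 hxu), inner_neg_left, neg_neg]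
  have hR : MeasurePreserving R (stdGaussian E) (stdGaussian E) :=
    ⟨R.continuous.measurable, stdGaussian_map R⟩
  have hflip := hR.integral_comp R.toHomeomorph.measurableEmbedding
    fun g ↦ ((unitSign (inner ℝ x g) : ℤ) : ℝ) * inner ℝ u g
  simp only [hRx, hRu, mul_neg, integral_neg] at hflip
  linarith

lemma integral_unitSign_mul_inner {x : E} (hx : ‖x‖ = 1) (u : E) :
    ∫ g, ((unitSign (inner ℝ x g) : ℤ) : ℝ) * inner ℝ u g ∂stdGaussian E =
      √(2 / π) * inner ℝ x u := by
  set r := u - inner ℝ x u • x with hr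
  have hxr : inner ℝ x r = 0 := by
    rw [inner_sub_right, real_inner_smul_right, real_inner_self_eq_norm_sq, hx]
    ring
  have hsplit (g : E) : ((unitSign (inner ℝ x g) : ℤ) : ℝ) * inner ℝ u g =
      inner ℝ x u * |inner ℝ x g| + ((unitSign (inner ℝ x g) : ℤ) : ℝ) * inner ℝ r g := by
    rw [← unitSign_mul_self, hr, inner_sub_left, real_inner_smul_left]
    ring
  simp_rw [hsplit]
  rw [integral_add (((memLp_inner_stdGaussian x).integrable one_le_two).abs.const_mul _)
    (integrable_unitSign_mul_inner x r), integral_unitSign_mul_inner_of_inner_eq_zero hxr,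
    integral_const_mul, integral_abs_inner_stdGaussian hx, add_zero, mul_comm]

variable {α β : Type*}

lemma integral_sum_mul_unitSign_mul_inner {J : Finset β} (a : β → ℝ) {x : β → E}
    (hx : ∀ j ∈ J, ‖x j‖ = 1) (u : E) :
    Integrable (fun g ↦ (∑ j ∈ J, a j * (unitSign (inner ℝ (x j) g) : ℤ)) * inner ℝ u g)
        (stdGaussian E) ∧
      ∫ g, (∑ j ∈ J, a j * (unitSign (inner ℝ (x j) g) : ℤ)) * inner ℝ u g ∂stdGaussian E =
        √(2 / π) * inner ℝ (∑ j ∈ J, a j • x j) u := by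
  have hint (j : β) := (integrable_unitSign_mul_inner (x j) u).const_mul (a j)
  simp only [sum_mul, mul_assoc]
  refine ⟨integrable_finsetSum _ fun j _ ↦ hint j, ?_⟩
  rw [integral_finsetSum _ fun j _ ↦ hint j, sum_inner, mul_sum]
  refine sum_congr rfl fun j hj ↦ ?_
  rw [integral_const_mul, integral_unitSign_mul_inner (hx j hj), real_inner_smul_left,
    mul_left_comm]

lemma sum_mul_le_sum_sq_div_add_mul_sum_sq (I : Finset α) (f g : α → ℝ) {c : ℝ} (hc : 0 < c) :
    ∑ i ∈ I, f i * g i ≤ (∑ i ∈ I, f i ^ 2) / (2 * c) + c / 2 * ∑ i ∈ I, g i ^ 2 := by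
  rw [sum_div, mul_sum, ← sum_add_distrib]
  refine sum_le_sum fun i _ ↦ ?_
  have hsq : f i ^ 2 / (2 * c) + c / 2 * g i ^ 2 - f i * g i = (f i - c * g i) ^ 2 / (2 * c) := by
    field_simp
    ring
  have : 0 ≤ (f i - c * g i) ^ 2 / (2 * c) := by positivity
  linarith

lemma mul_sum_norm_sum_smul_sq_le {I : Finset α} {J : Finset β} {B : α → β → ℝ} {K : ℝ}
    (hB : ∀ ε : β → ℤˣ, ∑ i ∈ I, (∑ j ∈ J, B i j * (ε j : ℤ)) ^ 2 ≤ K)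
    {x : β → E} (hx : ∀ j ∈ J, ‖x j‖ = 1) {c : ℝ} (hc : 0 < c) :
    √(2 / π) * ∑ i ∈ I, ‖∑ j ∈ J, B i j • x j‖ ^ 2 ≤
      K / (2 * c) + c / 2 * ∑ i ∈ I, ‖∑ j ∈ J, B i j • x j‖ ^ 2 := by
  set b : α → E := fun i ↦ ∑ j ∈ J, B i j • x j
  have hcorr (i : α) := integral_sum_mul_unitSign_mul_inner (B i) hx (b i)
  have hsq_int : Integrable (fun g ↦ c / 2 * ∑ i ∈ I, inner ℝ (b i) g ^ 2) (stdGaussian E) :=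
    (integrable_finsetSum _ fun i _ ↦ (memLp_inner_stdGaussian (b i)).integrable_sq).const_mul _
  have hyoung (g : E) :
      ∑ i ∈ I, (∑ j ∈ J, B i j * (unitSign (inner ℝ (x j) g) : ℤ)) * inner ℝ (b i) g ≤
        K / (2 * c) + c / 2 * ∑ i ∈ I, inner ℝ (b i) g ^ 2 := by
    refine (sum_mul_le_sum_sq_div_add_mul_sum_sq I _ _ hc).trans ?_
    gcongr
    exact hB _
  calc √(2 / π) * ∑ i ∈ I, ‖b i‖ ^ 2 = ∫ g, ∑ i ∈ I,
        (∑ j ∈ J, B i j * (unitSign (inner ℝ (x j) g) : ℤ)) * inner ℝ (b i) g ∂stdGaussian E := by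
        rw [integral_finsetSum _ fun i _ ↦ (hcorr i).1, mul_sum]
        exact sum_congr rfl fun i _ ↦ by rw [(hcorr i).2, real_inner_self_eq_norm_sq]
    _ ≤ ∫ g, K / (2 * c) + c / 2 * ∑ i ∈ I, inner ℝ (b i) g ^ 2 ∂stdGaussian E :=
        integral_mono (integrable_finsetSum _ fun i _ ↦ (hcorr i).1)
          ((integrable_const _).add hsq_int) hyoung
    _ = K / (2 * c) + c / 2 * ∑ i ∈ I, ‖b i‖ ^ 2 := by
        rw [integral_add (integrable_const _) hsq_int, integral_const_mul, integral_finsetSum _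
          fun i _ ↦ (memLp_inner_stdGaussian (b i)).integrable_sq]
        simp only [integral_const, probReal_univ, one_smul, integral_inner_sq_stdGaussian]

theorem sum_norm_sum_smul_sq_le {I : Finset α} {J : Finset β} {B : α → β → ℝ} {K : ℝ}
    (hB : ∀ ε : β → ℤˣ, ∑ i ∈ I, (∑ j ∈ J, B i j * (ε j : ℤ)) ^ 2 ≤ K)
    {x : β → E} (hx : ∀ j ∈ J, ‖x j‖ = 1) :
    ∑ i ∈ I, ‖∑ j ∈ J, B i j • x j‖ ^ 2 ≤ π / 2 * K := by
  set N := ∑ i ∈ I, ‖∑ j ∈ J, B i j • x j‖ ^ 2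
  set c := √(2 / π)
  have hc : 0 < c := by positivity
  have hc_sq : c ^ 2 = 2 / π := sq_sqrt (by positivity)
  have hle : c * N ≤ K / (2 * c) + c / 2 * N := mul_sum_norm_sum_smul_sq_le hB hx hc
  calc N = 2 / c * (c / 2 * N) := by field_simp
    _ ≤ 2 / c * (K / (2 * c)) := by gcongr; linarith
    _ = K / c ^ 2 := by field_simp
    _ = π / 2 * K := by rw [hc_sq]; field_simp

end Rounding

/-! ### Pseudorandomness of the boundary edges -/

section Pseudorandomness

open Filter Topology

variable {n : ℕ}

/-- The entry at `w`, `v` of the matrix `1 - M / p`, where `M` is the adjacency matrix of the edge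
set `E`; on the boundary of `S` these entries have mean zero under `boundaryLaw S p`. -/
noncomputable def centred (p : ℝ) (E : Set (Sym2 (Fin n))) (w v : Fin n) : ℝ :=
  1 - memInd E s(w, v) / p

/-- The properties of the boundary edges on which the analysis rests: every vertex outside `S` has
at least half its expected degree into `S`, and the centred matrix, as an operator from
`ℓ^∞(Sᶜ)` to `ℓ²(S)`, has norm `O(n / √p)`. -/
def IsPseudorandom (S : Finset (Fin n)) (p : ℝ) (E : Set (Sym2 (Fin n))) : Prop :=
  (∀ v ∉ S, p * #S / 2 < ∑ w ∈ S, memInd E s(w, v)) ∧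
    ∀ ε : Fin n → ℤˣ,
      ∑ w ∈ S, (∑ v ∈ Sᶜ, centred p E w v * (ε v : ℤ)) ^ 2 ≤ 320 * (n : ℝ) ^ 2 / p

instance (S : Finset (Fin n)) (p : unitInterval) : IsProbabilityMeasure (boundaryLaw S p) :=
  inferInstanceAs (IsProbabilityMeasure (setBernoulli _ _))

lemma mk_mem_boundary {S : Finset (Fin n)} {w v : Fin n} (hw : w ∈ S) (hv : v ∉ S) :
    s(w, v) ∈ boundary S :=
  ⟨w, hw, v, hv, rfl⟩

lemma sym2_mk_left_injective (v : Fin n) : Function.Injective fun w : Fin n ↦ s(w, v) :=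
  fun _ _ ↦ Sym2.congr_left.1

lemma sym2_mk_right_injective (w : Fin n) : Function.Injective fun v : Fin n ↦ s(w, v) :=
  fun _ _ ↦ Sym2.congr_right.1

lemma sym2_mk_injective_prod_compl (S : Finset (Fin n)) :
    Function.Injective fun i : S × (Sᶜ : Finset (Fin n)) ↦ s((i.1 : Fin n), (i.2 : Fin n)) := by
  rintro ⟨w, v⟩ ⟨w', v'⟩ h
  obtain ⟨hw, hv⟩ | ⟨hwv', -⟩ := Sym2.eq_iff.1 h
  · exact Prod.ext (Subtype.ext hw) (Subtype.ext hv)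
  · exact absurd w.2 (hwv' ▸ mem_compl.1 v'.2)

lemma card_le_card_fin (A : Finset (Fin n)) : (#A : ℝ) ≤ n := by
  exact_mod_cast card_finset_fin_le A

lemma iIndepFun_sum_centred (S : Finset (Fin n)) (p : unitInterval) (ε : Fin n → ℝ) :
    iIndepFun (fun (w : S) E ↦ ∑ v ∈ Sᶜ, centred p E w v * ε v) (boundaryLaw S p) := by
  have hcurry := iIndepFun_curry (fun _ ↦ measurable_memInd _)
    ((iIndepFun_memInd (boundary S) p).precomp (sym2_mk_injective_prod_compl S))
  refine (hcurry.comp (fun _ (m : (Sᶜ : Finset (Fin n)) → ℝ) ↦ ∑ v, (1 - m v / p) * ε v)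
    fun _ ↦ by fun_prop).congr fun w ↦ .of_forall fun E ↦ ?_
  exact sum_coe_sort Sᶜ fun v ↦ centred p E w v * ε v

lemma measurable_sum_centred (S : Finset (Fin n)) (p : ℝ) (ε : Fin n → ℝ) (w : Fin n) :
    Measurable fun E ↦ ∑ v ∈ S, centred p E w v * ε v :=
  measurable_fun_sum _ fun v _ ↦ (((measurable_memInd s(w, v)).div_const p).const_sub 1).mul_const _

lemma abs_sum_centred_le {p : ℝ} (hp : 0 < p) {ε : Fin n → ℝ} (hε : ∀ v, |ε v| ≤ 1)
    {T : Finset (Fin n)} {E : Set (Sym2 (Fin n))} {w : Fin n}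
    (hdeg : ∑ v ∈ T, memInd E s(w, v) ≤ 3 * (p * n)) :
    |∑ v ∈ T, centred p E w v * ε v| ≤ 4 * n := by
  have hterm (v : Fin n) : |centred p E w v * ε v| ≤ 1 + memInd E s(w, v) / p := by
    have hnonneg : 0 ≤ memInd E s(w, v) / p := div_nonneg (memInd_nonneg _ _) hp.le
    rw [abs_mul]
    refine (mul_le_of_le_one_right (abs_nonneg _) (hε v)).trans ?_
    rw [centred, abs_le]
    constructor <;> linarith
  calc |∑ v ∈ T, centred p E w v * ε v| ≤ ∑ v ∈ T, |centred p E w v * ε v| :=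
        abs_sum_le_sum_abs _ _
    _ ≤ ∑ v ∈ T, (1 + memInd E s(w, v) / p) := sum_le_sum fun v _ ↦ hterm v
    _ = #T + (∑ v ∈ T, memInd E s(w, v)) / p := by
        rw [sum_add_distrib, sum_const, nsmul_one, sum_div]
    _ ≤ n + 3 * n := by
        refine add_le_add (card_le_card_fin T) ((div_le_iff₀ hp).2 ?_)
        linarith
    _ = 4 * n := by ring

lemma measureReal_sum_sq_sum_centred_ge_le {S : Finset (Fin n)} {p : unitInterval} (hp : 0 < p)
    {ε : Fin n → ℝ} (hε : ∀ v, |ε v| ≤ 1) :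
    (boundaryLaw S p).real {E | (∀ w ∈ S, |∑ v ∈ Sᶜ, centred p E w v * ε v| ≤ 4 * n) ∧
      320 * (n : ℝ) ^ 2 / p ≤ ∑ w ∈ S, (∑ v ∈ Sᶜ, centred p E w v * ε v) ^ 2} ≤
      12 ^ n * exp (-(5 * n)) := by
  have hp' : (0 : ℝ) < p := hp
  obtain rfl | hn := n.eq_zero_or_pos
  · simp
  have : (0 : ℝ) < n := by exact_mod_cast hn
  have hboundary (w : S) : ∀ v ∈ Sᶜ, s((w : Fin n), v) ∈ boundary S :=
    fun v hv ↦ mk_mem_boundary w.2 (mem_compl.1 hv)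
  have hbound := measureReal_sum_sq_ge_le (iIndepFun_sum_centred S p ε)
    (fun w ↦ measurable_sum_centred Sᶜ p ε w) (M := p) (σ := n / p) hp'.le (by positivity)
    (fun w t _ ↦ integrable_exp_mul_sum_comp_memInd (sym2_mk_right_injective _) (hboundary w)
      (g := fun v b ↦ (1 - b / p) * ε v) (by fun_prop) t)
    (fun w t ht ↦ (mgf_sum_one_sub_memInd_div_mul_le hp (sym2_mk_right_injective _)
      (hboundary w) hε ht).trans ?_) (320 * n ^ 2 / p)
  · refine le_trans (measureReal_mono ?_) (hbound.trans ?_)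
    · rintro E ⟨habs, hsq⟩
      refine ⟨fun w ↦ (habs w w.2).trans_eq ?_, hsq.trans_eq (sum_coe_sort S _).symm⟩
      field_simp
    · rw [Fintype.card_coe]
      have hexponent : 320 * (n : ℝ) ^ 2 / p / (n / p) / 64 = 5 * n := by
        field_simp
        norm_num
      rw [hexponent]
      gcongr
      · norm_num
      · exact card_finset_fin_le S
  · gcongr
    exact card_finset_fin_le _

lemma measureReal_biUnion_finset_le_mul {Ω κ : Type*} [MeasurableSpace Ω] {μ : Measure Ω}
    {T : Finset κ} {B : κ → Set Ω} {m b : ℝ} (hT : #T ≤ m) (hb : 0 ≤ b)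
    (hB : ∀ i ∈ T, μ.real (B i) ≤ b) : μ.real (⋃ i ∈ T, B i) ≤ m * b :=
  calc μ.real (⋃ i ∈ T, B i) ≤ ∑ i ∈ T, μ.real (B i) := measureReal_biUnion_finset_le T B
    _ ≤ #T • b := sum_le_card_nsmul _ _ _ hB
    _ ≤ m * b := by
      rw [nsmul_eq_mul]
      gcongr

lemma measureReal_not_isPseudorandom_le (S : Finset (Fin n)) {p : unitInterval} (hp : 0 < p) :
    (boundaryLaw S p).real {E | ¬IsPseudorandom S p E} ≤
      n * exp (-(p * #S / 10)) + n * exp (-(p * n)) + 2 ^ n * (12 ^ n * exp (-(5 * n))) := by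
  have hp' : (0 : ℝ) < p := hp
  set lowDegree : Fin n → Set (Set (Sym2 (Fin n))) :=
    fun v ↦ {E | ∑ w ∈ S, memInd E s(w, v) ≤ p * #S / 2}
  set highDegree : Fin n → Set (Set (Sym2 (Fin n))) :=
    fun w ↦ {E | 3 * (p * (n : ℝ)) ≤ ∑ v ∈ Sᶜ, memInd E s(w, v)}
  set largeSum : (Fin n → ℤˣ) → Set (Set (Sym2 (Fin n))) := fun ε ↦
    {E | (∀ w ∈ S, |∑ v ∈ Sᶜ, centred p E w v * (ε v : ℤ)| ≤ 4 * n) ∧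
      320 * (n : ℝ) ^ 2 / p ≤ ∑ w ∈ S, (∑ v ∈ Sᶜ, centred p E w v * (ε v : ℤ)) ^ 2}
  have hsub : {E | ¬IsPseudorandom S p E} ⊆
      ((⋃ v ∈ Sᶜ, lowDegree v) ∪ ⋃ w ∈ S, highDegree w) ∪ ⋃ ε ∈ univ, largeSum ε := by
    intro E
    contrapose!
    simp only [Set.mem_union, Set.mem_iUnion, not_or, not_exists, mem_compl, lowDegree, highDegree,
      largeSum, Set.mem_ofPred_eq, not_not, not_le, not_and, mem_univ, true_imp_iff]
    rintro ⟨⟨hlow, hhigh⟩, hlarge⟩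
    exact ⟨hlow, fun ε ↦ (hlarge ε fun w hw ↦
      abs_sum_centred_le hp' (fun v ↦ (abs_cast_intUnit (ε v)).le) (hhigh w hw).le).le⟩
  have hlow := measureReal_biUnion_finset_le_mul (card_le_card_fin Sᶜ) (exp_pos _).le fun v hv ↦
    measureReal_sum_memInd_le_le (u := boundary S) (p := p) (sym2_mk_left_injective v)
      fun w hw ↦ mk_mem_boundary hw (mem_compl.1 hv)
  have hhigh := measureReal_biUnion_finset_le_mul (card_le_card_fin S) (exp_pos _).le fun w hw ↦
    measureReal_le_sum_memInd_le (u := boundary S) (p := p) (sym2_mk_right_injective w)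
      (fun v hv ↦ mk_mem_boundary hw (mem_compl.1 hv)) (card_le_card_fin Sᶜ)
  have hlarge := measureReal_biUnion_finset_le_mul (T := (univ : Finset (Fin n → ℤˣ)))
    (m := 2 ^ n) (by simp) (by positivity) fun ε _ ↦
      measureReal_sum_sq_sum_centred_ge_le (S := S) hp fun v ↦ (abs_cast_intUnit (ε v)).le
  exact (measureReal_mono hsub).trans <| (measureReal_union_le _ _).trans <|
    add_le_add ((measureReal_union_le _ _).trans (add_le_add hlow hhigh)) hlarge

lemma pow_mul_pow_mul_exp_le (n : ℕ) : (2 : ℝ) ^ n * (12 ^ n * exp (-(5 * n))) ≤ exp (-n) := by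
  have hexp : (24 : ℝ) ≤ exp 1 ^ 4 :=
    calc (24 : ℝ) ≤ 2.7 ^ 4 := by norm_num
      _ ≤ exp 1 ^ 4 := by gcongr; linarith [exp_one_gt_d9]
  calc (2 : ℝ) ^ n * (12 ^ n * exp (-(5 * n))) = 24 ^ n * exp (-(5 * n)) := by
        rw [← mul_assoc, ← mul_pow]
        norm_num
    _ ≤ (exp 1 ^ 4) ^ n * exp (-(5 * n)) := by gcongr
    _ = exp (-n) := by
        rw [← exp_nat_mul, ← exp_nat_mul, ← exp_add]
        push_cast
        ring_nf

lemma tendsto_mul_exp_neg_sqrt_add_exp_neg :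
    Tendsto (fun n : ℕ ↦ 2 * (n * exp (-(√n / 10))) + exp (-(n : ℝ))) atTop (𝓝 0) := by
  have hsqrt : Tendsto (fun n : ℕ ↦ √(n : ℝ)) atTop atTop :=
    tendsto_sqrt_atTop.comp tendsto_natCast_atTop_atTop
  have hfirst := (tendsto_rpow_mul_exp_neg_mul_atTop_nhds_zero 2 (1 / 10) (by norm_num)).comp hsqrt
  have hsecond := tendsto_exp_neg_atTop_nhds_zero.comp (tendsto_natCast_atTop_atTop (R := ℝ))
  convert (hfirst.const_mul 2).add hsecond using 2 with n
  · simp only [Function.comp_apply, rpow_two, sq_sqrt (Nat.cast_nonneg n)]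
    ring_nf
  · simp

theorem exists_forall_le_measureReal_isPseudorandom {δ : ℝ} (hδ : 0 < δ) :
    ∃ N : ℕ, ∀ n ≥ N, ∀ (p : unitInterval) (S : Finset (Fin n)), 0 < p → √n ≤ p * #S →
      1 - δ ≤ (boundaryLaw S p).real {E | IsPseudorandom S p E} := by
  obtain ⟨N, hN⟩ :=
    eventually_atTop.1 (tendsto_mul_exp_neg_sqrt_add_exp_neg.eventually_le_const hδ)
  refine ⟨N, fun n hn p S hp hpS ↦ ?_⟩
  have hpn : p * (#S : ℝ) ≤ p * n := mul_le_mul_of_nonneg_left (card_le_card_fin S) p.2.1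
  have hdeg : (n : ℝ) * exp (-(p * #S / 10)) ≤ n * exp (-(√n / 10)) := by gcongr
  have hrow : (n : ℝ) * exp (-(p * n)) ≤ n * exp (-(√n / 10)) := by
    gcongr
    linarith [sqrt_nonneg (n : ℝ)]
  have hcompl := probReal_compl_eq_one_sub (μ := boundaryLaw S p)
    (MeasurableSet.of_discrete (s := {E | IsPseudorandom S p E}))
  rw [Set.compl_ofPred] at hcompl
  linarith [hN n hn, measureReal_not_isPseudorandom_le S hp, pow_mul_pow_mul_exp_le n]

end Pseudorandomness

/-! ### Optimal solutions of the crude semidefinite program -/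

section Program

variable {n : ℕ} {G : SimpleGraph (Fin n)} {x : Fin n → EuclideanSpace ℝ (Fin n)}

lemma IsFeasible.norm_eq_one (hx : IsFeasible G x) (v : Fin n) : ‖x v‖ = 1 := by
  rw [← sqrt_sq (norm_nonneg (x v)), hx.norm_sq_eq_one, sqrt_one]

lemma IsFeasible.norm_sub_sq (hx : IsFeasible G x) (u v : Fin n) :
    ‖x u - x v‖ ^ 2 = 2 - 2 * inner ℝ (x u) (x v) := by
  rw [norm_sub_sq_real, hx.norm_sq_eq_one, hx.norm_sq_eq_one]
  ring

variable (G) in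
lemma isClosed_setOf_isFeasible : IsClosed {x | IsFeasible G x} := by
  have hset : {x | IsFeasible G x} = (⋂ u, {x | ‖x u‖ ^ 2 = 1}) ∩
      ((⋂ u, ⋂ v, {x | 0 ≤ inner ℝ (x u) (x v)}) ∩
        ⋂ u, ⋂ v, ⋂ _ : G.Adj u v, {x | inner ℝ (x u) (x v) = 0}) := by
    ext x
    simp only [Set.mem_inter_iff, Set.mem_iInter, Set.mem_ofPred_eq]
    exact ⟨fun h ↦ ⟨h.1, h.2, h.3⟩, fun h ↦ ⟨h.1, h.2.1, h.2.2⟩⟩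
  rw [hset]
  refine (isClosed_iInter fun u ↦ isClosed_eq (by fun_prop) continuous_const).inter
    ((isClosed_iInter fun u ↦ isClosed_iInter fun v ↦ isClosed_le continuous_const ?_).inter
      (isClosed_iInter fun u ↦ isClosed_iInter fun v ↦ isClosed_iInter fun _ ↦
        isClosed_eq ?_ continuous_const)) <;> fun_prop

variable (G) in
lemma isCompact_setOf_isFeasible : IsCompact {x | IsFeasible G x} := by
  refine (isCompact_closedBall 0 1).of_isClosed_subset (isClosed_setOf_isFeasible G) fun x hx ↦ ?_
  rw [mem_closedBall_zero_iff, pi_norm_le_iff_of_nonneg zero_le_one]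
  exact fun u ↦ (IsFeasible.norm_eq_one hx u).le

variable (G) in
lemma isFeasible_single : IsFeasible G fun u ↦ EuclideanSpace.single u 1 where
  norm_sq_eq_one := by simp
  inner_nonneg u v := by
    by_cases h : u = v <;> simp [EuclideanSpace.inner_single_left, h]
  inner_eq_zero u v h := by simp [EuclideanSpace.inner_single_left, h.ne]

lemma continuous_objective :
    Continuous (objective : (Fin n → EuclideanSpace ℝ (Fin n)) → ℝ) := by
  unfold objective
  fun_prop

variable (G) in
theorem exists_isOptimal : ∃ x, IsOptimal G x := by
  obtain ⟨x, hx, hmin⟩ := (isCompact_setOf_isFeasible G).exists_isMinOn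
    ⟨_, isFeasible_single G⟩ continuous_objective.continuousOn
  exact ⟨x, hx, fun y hy ↦ hmin hy⟩

lemma exists_norm_eq_one_forall_inner_eq_zero {F : Type*} [NormedAddCommGroup F]
    [InnerProductSpace ℝ F] [FiniteDimensional ℝ F] {s : Finset F}
    (hs : #s < Module.finrank ℝ F) : ∃ e : F, ‖e‖ = 1 ∧ ∀ y ∈ s, inner ℝ e y = 0 := by
  set U := Submodule.span ℝ (s : Set F)
  have hU : Uᗮ ≠ ⊥ := by
    rw [Ne, Submodule.orthogonal_eq_bot_iff]
    intro htop
    have hfinrank : Module.finrank ℝ U ≤ #s := finrank_span_finset_le_card s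
    rw [htop, finrank_top] at hfinrank
    omega
  obtain ⟨e, he, hne⟩ := Submodule.exists_mem_ne_zero_of_ne_bot hU
  refine ⟨(‖e‖⁻¹ : ℝ) • e, norm_smul_inv_norm hne, fun y hy ↦ ?_⟩
  rw [real_inner_smul_left, Submodule.inner_left_of_mem_orthogonal (Submodule.subset_span hy) he,
    mul_zero]

lemma IsFeasible.piecewise (hx : IsFeasible G x) {S : Finset (Fin n)}
    (hS : G.IsIndepSet (S : Set (Fin n))) {e : EuclideanSpace ℝ (Fin n)} (he : ‖e‖ = 1)
    (hex : ∀ v ∉ S, inner ℝ e (x v) = 0) : IsFeasible G (S.piecewise (fun _ ↦ e) x) where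
  norm_sq_eq_one u := by
    by_cases hu : u ∈ S <;> simp [hu, he, hx.norm_eq_one]
  inner_nonneg u v := by
    by_cases hu : u ∈ S <;> by_cases hv : v ∈ S <;>
      simp [hu, hv, hex, real_inner_comm e, hx.inner_nonneg]
  inner_eq_zero u v huv := by
    by_cases hu : u ∈ S <;> by_cases hv : v ∈ S
    · exact absurd huv (hS hu hv huv.ne)
    all_goals simp [hu, hv, hex, real_inner_comm e, hx.inner_eq_zero u v huv]

lemma sum_sum_eq_sum_blocks {ι : Type*} [Fintype ι] [DecidableEq ι] (S : Finset ι)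
    {f : ι → ι → ℝ} (hf : ∀ u v, f u v = f v u) :
    ∑ u, ∑ v, f u v = ∑ u ∈ S, ∑ v ∈ S, f u v + 2 * ∑ u ∈ S, ∑ v ∈ Sᶜ, f u v +
      ∑ u ∈ Sᶜ, ∑ v ∈ Sᶜ, f u v := by
  have hswap : ∑ u ∈ Sᶜ, ∑ v ∈ S, f u v = ∑ u ∈ S, ∑ v ∈ Sᶜ, f u v := by
    rw [sum_comm]
    exact sum_congr rfl fun u _ ↦ sum_congr rfl fun v _ ↦ hf v u
  simp only [← sum_add_sum_compl S, sum_add_distrib, hswap]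
  ring

lemma objective_eq_sum_blocks (S : Finset (Fin n)) (x : Fin n → EuclideanSpace ℝ (Fin n)) :
    objective x = ∑ u ∈ S, ∑ v ∈ S, ‖x u - x v‖ ^ 2 +
      2 * ∑ u ∈ S, ∑ v ∈ Sᶜ, ‖x u - x v‖ ^ 2 + ∑ u ∈ Sᶜ, ∑ v ∈ Sᶜ, ‖x u - x v‖ ^ 2 :=
  sum_sum_eq_sum_blocks S fun u v ↦ by rw [norm_sub_rev]

/-- Collapsing `S` to a unit vector orthogonal to all the other vectors gives a feasible solution,
so it cannot decrease the objective. -/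
theorem IsOptimal.sum_sum_norm_sub_sq_le (hx : IsOptimal G x) {S : Finset (Fin n)}
    (hS : G.IsIndepSet (S : Set (Fin n))) :
    ∑ u ∈ S, ∑ v ∈ S, ‖x u - x v‖ ^ 2 ≤ 4 * ∑ u ∈ S, ∑ v ∈ Sᶜ, inner ℝ (x u) (x v) := by
  obtain rfl | hne := S.eq_empty_or_nonempty
  · simp
  have hcard : #(Sᶜ.image x) < Module.finrank ℝ (EuclideanSpace ℝ (Fin n)) := by
    rw [finrank_euclideanSpace]
    exact card_image_le.trans_lt (S.card_compl_lt_iff_nonempty.2 hne)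
  obtain ⟨e, he, hex⟩ := exists_norm_eq_one_forall_inner_eq_zero hcard
  replace hex : ∀ v ∉ S, inner ℝ e (x v) = 0 :=
    fun v hv ↦ hex _ (mem_image_of_mem x (mem_compl.2 hv))
  set y := S.piecewise (fun _ ↦ e) x
  have hyS {v : Fin n} (hv : v ∈ S) : y v = e := piecewise_eq_of_mem _ _ _ hv
  have hyS' {v : Fin n} (hv : v ∈ Sᶜ) : y v = x v :=
    piecewise_eq_of_notMem _ _ _ (mem_compl.1 hv)
  have hy : IsFeasible G y := hx.1.piecewise hS he hex
  have hinner : ∑ u ∈ S, ∑ v ∈ S, ‖y u - y v‖ ^ 2 = 0 :=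
    sum_eq_zero fun u hu ↦ sum_eq_zero fun v hv ↦ by simp [hyS hu, hyS hv]
  have hboundary : ∑ u ∈ S, ∑ v ∈ Sᶜ, ‖y u - y v‖ ^ 2 = ∑ u ∈ S, ∑ v ∈ Sᶜ, 2 :=
    sum_congr rfl fun u hu ↦ sum_congr rfl fun v hv ↦ by
      rw [hy.norm_sub_sq, hyS hu, hyS' hv, hex v (mem_compl.1 hv), mul_zero, sub_zero]
  have houter : ∑ u ∈ Sᶜ, ∑ v ∈ Sᶜ, ‖y u - y v‖ ^ 2 = ∑ u ∈ Sᶜ, ∑ v ∈ Sᶜ, ‖x u - x v‖ ^ 2 :=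
    sum_congr rfl fun u hu ↦ sum_congr rfl fun v hv ↦ by rw [hyS' hu, hyS' hv]
  have hboundary_x : ∑ u ∈ S, ∑ v ∈ Sᶜ, ‖x u - x v‖ ^ 2 =
      ∑ u ∈ S, ∑ v ∈ Sᶜ, 2 - 2 * ∑ u ∈ S, ∑ v ∈ Sᶜ, inner ℝ (x u) (x v) := by
    simp only [hx.1.norm_sub_sq, sum_sub_distrib, ← mul_sum]
  have hopt := hx.2 y hy
  rw [objective_eq_sum_blocks S x, objective_eq_sum_blocks S y, hinner, hboundary, houter,
    hboundary_x] at hopt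
  linarith

end Program

/-! ### The recovery algorithm -/

namespace Timed

variable {α β : Type}

@[simp]
lemma val_bind (m : Timed α) (f : α → Timed β) : (m >>= f).val = (f m.val).val := rfl

@[simp]
lemma steps_bind (m : Timed α) (f : α → Timed β) :
    (m >>= f).steps = m.steps + (f m.val).steps := rfl

@[simp]
lemma val_pure (a : α) : (pure a : Timed α).val = a := rfl

@[simp]
lemma steps_pure (a : α) : (pure a : Timed α).steps = 0 := rfl

@[simp]
lemma steps_tick (c : ℕ) : (tick c).steps = c := rfl

end Timed

section Algorithm

variable {n : ℕ} (G : SimpleGraph (Fin n)) (x : Fin n → EuclideanSpace ℝ (Fin n))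

/-- The list represents an independent set of `G`: its members are pairwise distinct and
nonadjacent. -/
def IsIndepList (l : List (Fin n)) : Prop :=
  l.Pairwise fun v w ↦ v ≠ w ∧ ¬G.Adj v w

variable {G} in
lemma IsIndepList.nodup {l : List (Fin n)} (hl : IsIndepList G l) : l.Nodup :=
  hl.imp And.left

variable {G} in
lemma IsIndepList.isIndepSet_toFinset {l : List (Fin n)} (hl : IsIndepList G l) :
    G.IsIndepSet (l.toFinset : Set (Fin n)) := by
  have : Std.Symm fun v w ↦ v ≠ w ∧ ¬G.Adj v w := ⟨fun v w h ↦ by rwa [ne_comm, G.adj_comm]⟩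
  intro v hv w hw hvw
  exact (hl.forall (List.mem_toFinset.1 hv) (List.mem_toFinset.1 hw) hvw).2

variable {G} in
lemma isIndepList_of_forall_mem {S : Finset (Fin n)} (hS : G.IsIndepSet (S : Set (Fin n)))
    {l : List (Fin n)} (hnodup : l.Nodup) (hl : ∀ v ∈ l, v ∈ S) : IsIndepList G l :=
  hnodup.pairwise_of_forall_ne fun v hv w hw hvw ↦ ⟨hvw, hS (hl v hv) (hl w hw) hvw⟩

lemma val_conflicts_eq_true_iff (v : Fin n) (l : List (Fin n)) :
    (conflicts G v l).val = true ↔ ∃ w ∈ l, v = w ∨ G.Adj v w := by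
  induction l with
  | nil => simp [conflicts]
  | cons w l ih =>
    by_cases h : v = w ∨ G.Adj v w
    · simp [conflicts, h]
    · simp [conflicts, h, ih]

lemma val_checkIndep_eq_true_iff (l : List (Fin n)) :
    (checkIndep G l).val = true ↔ IsIndepList G l := by
  induction l with
  | nil => simp [checkIndep, IsIndepList]
  | cons v l ih =>
    have hconflict : (∀ w ∈ l, v ≠ w ∧ ¬G.Adj v w) ↔ ¬(conflicts G v l).val = true := by
      rw [val_conflicts_eq_true_iff]
      push Not
      rfl
    rw [IsIndepList, List.pairwise_cons, hconflict, ← IsIndepList, ← ih]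
    by_cases h : (conflicts G v l).val = true <;> simp [checkIndep, h]

open Classical in
lemma val_ball (u : Fin n) (l : List (Fin n)) :
    (ball x u l).val = l.filter fun v ↦ dist (x u) (x v) < 1 := by
  induction l with
  | nil => rfl
  | cons v l ih => by_cases h : dist (x u) (x v) < 1 <;> simp [ball, h, ih]

lemma mem_val_ball {u v : Fin n} {l : List (Fin n)} :
    v ∈ (ball x u l).val ↔ v ∈ l ∧ dist (x u) (x v) < 1 := by
  rw [val_ball, List.mem_filter, decide_eq_true_iff]

lemma val_ball_sublist (u : Fin n) (l : List (Fin n)) : (ball x u l).val.Sublist l := by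
  rw [val_ball]
  exact List.filter_sublist

lemma val_extend_cons (v : Fin n) (l cur : List (Fin n)) :
    (extend G (v :: l) cur).val =
      if (conflicts G v cur).val then (extend G l cur).val else (extend G l (v :: cur)).val := by
  rw [extend, Timed.val_bind, Timed.val_bind, apply_ite Timed.val]

lemma subset_val_extend (l cur : List (Fin n)) : cur ⊆ (extend G l cur).val := by
  induction l generalizing cur with
  | nil => exact List.Subset.refl cur
  | cons v l ih =>
    rw [val_extend_cons]
    split_ifs
    · exact ih cur
    · exact List.Subset.trans (List.subset_cons_self v cur) (ih _)

lemma nodup_val_extend (l : List (Fin n)) {cur : List (Fin n)} (hcur : cur.Nodup) :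
    (extend G l cur).val.Nodup := by
  induction l generalizing cur with
  | nil => exact hcur
  | cons v l ih =>
    rw [val_extend_cons]
    split_ifs with h
    · exact ih hcur
    · rw [val_conflicts_eq_true_iff] at h
      exact ih (hcur.cons fun hv ↦ h ⟨v, hv, .inl rfl⟩)

lemma exists_mem_val_extend_eq_or_adj {l : List (Fin n)} (cur : List (Fin n)) {v : Fin n}
    (hv : v ∈ l) : ∃ w ∈ (extend G l cur).val, v = w ∨ G.Adj v w := by
  induction l generalizing cur with
  | nil => simp at hv
  | cons u l ih =>
    rw [val_extend_cons]
    obtain rfl | hv := List.mem_cons.1 hv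
    · split_ifs with h
      · obtain ⟨w, hw, hvw⟩ := (val_conflicts_eq_true_iff G v cur).1 h
        exact ⟨w, subset_val_extend G l cur hw, hvw⟩
      · exact ⟨v, subset_val_extend G l _ List.mem_cons_self, .inl rfl⟩
    · split_ifs
      · exact ih cur hv
      · exact ih _ hv

variable {G} in
lemma mem_of_mem_val_extend {S : Finset (Fin n)} (l : List (Fin n)) {cur : List (Fin n)}
    (hcur : ∀ v ∈ cur, v ∈ S) (hblock : ∀ v ∉ S, ∃ w ∈ cur, G.Adj v w) :
    ∀ v ∈ (extend G l cur).val, v ∈ S := by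
  induction l generalizing cur with
  | nil => exact hcur
  | cons u l ih =>
    rw [val_extend_cons]
    split_ifs with h
    · exact ih hcur hblock
    · have hu : u ∈ S := by
        by_contra hu
        obtain ⟨w, hw, huw⟩ := hblock u hu
        exact h ((val_conflicts_eq_true_iff G u cur).2 ⟨w, hw, .inr huw⟩)
      refine ih (List.forall_mem_cons.2 ⟨hu, hcur⟩) fun v hv ↦ ?_
      obtain ⟨w, hw, hvw⟩ := hblock v hv
      exact ⟨w, List.mem_cons_of_mem u hw, hvw⟩

lemma val_best_cons (u : Fin n) (l cur : List (Fin n)) :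
    (best G x (u :: l) cur).val =
      if (checkIndep G (candidate G x u).val).val ∧ cur.length < (candidate G x u).val.length then
        (best G x l (candidate G x u).val).val else (best G x l cur).val := by
  rw [best, Timed.val_bind, Timed.val_bind, Timed.val_bind, apply_ite Timed.val]

lemma isIndepList_val_best (l : List (Fin n)) {cur : List (Fin n)} (hcur : IsIndepList G cur) :
    IsIndepList G (best G x l cur).val := by
  induction l generalizing cur with
  | nil => exact hcur
  | cons u l ih =>
    rw [val_best_cons]
    split_ifs with h
    · exact ih ((val_checkIndep_eq_true_iff G _).1 h.1)
    · exact ih hcur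

lemma length_le_length_val_best (l cur : List (Fin n)) :
    cur.length ≤ (best G x l cur).val.length := by
  induction l generalizing cur with
  | nil => exact le_rfl
  | cons u l ih =>
    rw [val_best_cons]
    split_ifs with h
    · exact h.2.le.trans (ih _)
    · exact ih _

lemma length_candidate_le_length_val_best {l : List (Fin n)} (cur : List (Fin n)) {u : Fin n}
    (hu : u ∈ l) (hindep : IsIndepList G (candidate G x u).val) :
    (candidate G x u).val.length ≤ (best G x l cur).val.length := by
  induction l generalizing cur with
  | nil => simp at hu
  | cons v l ih =>
    rw [val_best_cons]
    obtain rfl | hu := List.mem_cons.1 hu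
    · rw [(val_checkIndep_eq_true_iff G _).2 hindep]
      split_ifs with h
      · exact length_le_length_val_best G x l _
      · rw [not_and, not_lt] at h
        exact (h rfl).trans (length_le_length_val_best G x l cur)
    · split_ifs
      · exact ih _ hu
      · exact ih _ hu

lemma isIndepList_val_recover : IsIndepList G (recover G x).val :=
  isIndepList_val_best G x _ .nil

theorem isIndepSet_output : G.IsIndepSet (output G x : Set (Fin n)) :=
  (isIndepList_val_recover G x).isIndepSet_toFinset

lemma card_output : #(output G x) = (recover G x).val.length :=
  List.toFinset_card_of_nodup (isIndepList_val_recover G x).nodup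

variable {G x}

theorem card_le_card_output {S : Finset (Fin n)} (hS : G.IsIndepSet (S : Set (Fin n))) {u : Fin n}
    (hball : ∀ v, dist (x u) (x v) < 1 → v ∈ S)
    (hblock : ∀ v ∉ S, ∃ w, dist (x u) (x w) < 1 ∧ G.Adj v w) :
    #S ≤ #(output G x) := by
  set l := (candidate G x u).val
  have hnodup : l.Nodup := nodup_val_extend G _
    ((List.nodup_finRange n).sublist (val_ball_sublist x u _))
  have hlS : ∀ v ∈ l, v ∈ S := by
    refine mem_of_mem_val_extend _ (fun v hv ↦ hball v ((mem_val_ball x).1 hv).2) fun v hv ↦ ?_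
    obtain ⟨w, hw, hvw⟩ := hblock v hv
    exact ⟨w, (mem_val_ball x).2 ⟨List.mem_finRange w, hw⟩, hvw⟩
  have hSl : S ⊆ l.toFinset := by
    intro v hv
    obtain ⟨w, hw, rfl | hvw⟩ :=
      exists_mem_val_extend_eq_or_adj G (ball x u (List.finRange n)).val (List.mem_finRange v)
    · exact List.mem_toFinset.2 hw
    · exact absurd hvw (hS hv (hlS w hw) hvw.ne)
  calc #S ≤ #l.toFinset := card_le_card hSl
    _ = l.length := List.toFinset_card_of_nodup hnodup
    _ ≤ #(output G x) := by
      rw [card_output]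
      exact length_candidate_le_length_val_best G x [] (List.mem_finRange u)
        (isIndepList_of_forall_mem hS hnodup hlS)

end Algorithm

/-! ### Running time -/

section RunningTime

variable {n : ℕ} (G : SimpleGraph (Fin n)) (x : Fin n → EuclideanSpace ℝ (Fin n))

lemma steps_conflicts_le (v : Fin n) (l : List (Fin n)) :
    (conflicts G v l).steps ≤ 3 * l.length + 1 := by
  induction l with
  | nil => simp [conflicts]
  | cons w l ih =>
    rw [conflicts, Timed.steps_bind, Timed.steps_tick, apply_ite Timed.steps, Timed.steps_pure,
      List.length_cons]
    split_ifs <;> omega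

lemma steps_ball_le (u : Fin n) (l : List (Fin n)) :
    (ball x u l).steps ≤ (3 * n + 3) * l.length + 1 := by
  induction l with
  | nil => simp [ball]
  | cons v l ih =>
    rw [ball, Timed.steps_bind, Timed.steps_bind, apply_ite Timed.steps, Timed.steps_pure,
      Timed.steps_pure, Timed.steps_tick, ite_self, List.length_cons]
    linarith

lemma length_val_extend_le (l cur : List (Fin n)) :
    (extend G l cur).val.length ≤ l.length + cur.length := by
  induction l generalizing cur with
  | nil => simp [extend]
  | cons v l ih =>
    have hskip := ih cur
    have hadd := ih (v :: cur)
    rw [val_extend_cons]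
    rw [List.length_cons] at hadd ⊢
    split_ifs <;> omega

lemma steps_extend_le (l cur : List (Fin n)) :
    (extend G l cur).steps ≤ l.length * (3 * (l.length + cur.length) + 3) + 1 := by
  induction l generalizing cur with
  | nil => simp [extend]
  | cons v l ih =>
    have hconflicts := steps_conflicts_le G v cur
    have hskip := ih cur
    have hadd := ih (v :: cur)
    rw [extend, Timed.steps_bind, Timed.steps_bind, apply_ite Timed.steps, Timed.steps_tick]
    rw [List.length_cons] at hadd ⊢
    split_ifs <;> nlinarith

lemma steps_checkIndep_le (l : List (Fin n)) :
    (checkIndep G l).steps ≤ l.length * (3 * l.length + 2) + 1 := by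
  induction l with
  | nil => simp [checkIndep]
  | cons v l ih =>
    have hconflicts := steps_conflicts_le G v l
    rw [checkIndep, Timed.steps_bind, Timed.steps_bind, apply_ite Timed.steps, Timed.steps_tick,
      Timed.steps_pure, List.length_cons]
    split_ifs <;> nlinarith

lemma length_val_ball_finRange_le (u : Fin n) :
    (ball x u (List.finRange n)).val.length ≤ n :=
  (val_ball_sublist x u _).length_le.trans_eq List.length_finRange

lemma length_val_candidate_le (u : Fin n) : (candidate G x u).val.length ≤ 2 * n := by
  have hball := length_val_ball_finRange_le x u
  have hextend := length_val_extend_le G (List.finRange n) (ball x u (List.finRange n)).val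
  rw [List.length_finRange] at hextend
  rw [candidate, Timed.val_bind]
  omega

lemma steps_candidate_le (u : Fin n) : (candidate G x u).steps ≤ 9 * n ^ 2 + 6 * n + 2 := by
  have hlength := length_val_ball_finRange_le x u
  have hball := steps_ball_le x u (List.finRange n)
  have hextend := steps_extend_le G (List.finRange n) (ball x u (List.finRange n)).val
  rw [List.length_finRange] at hball hextend
  rw [candidate, Timed.steps_bind]
  nlinarith

lemma steps_best_le (l : List (Fin n)) {cur : List (Fin n)} (hcur : cur.length ≤ 2 * n) :
    (best G x l cur).steps ≤ l.length * (21 * n ^ 2 + 14 * n + 5) + 1 := by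
  induction l generalizing cur with
  | nil => simp [best]
  | cons u l ih =>
    have hlength := length_val_candidate_le G x u
    have hcandidate := steps_candidate_le G x u
    have hcheck : (checkIndep G (candidate G x u).val).steps ≤ 2 * n * (3 * (2 * n) + 2) + 1 :=
      (steps_checkIndep_le G _).trans (by gcongr)
    have hkeep := ih hcur
    have hreplace := ih hlength
    rw [best, Timed.steps_bind, Timed.steps_bind, Timed.steps_bind, apply_ite Timed.steps,
      Timed.steps_tick, List.length_cons]
    split_ifs <;> nlinarith

theorem steps_recover_le : (recover G x).steps ≤ n * (21 * n ^ 2 + 14 * n + 5) + 1 := by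
  simpa [recover] using steps_best_le G x (List.finRange n) (cur := []) (by simp)

end RunningTime

/-! ### Concentration of an optimal solution -/

section Mean

variable {ι F : Type*}

/-- The arithmetic mean of the vectors `x i`, `i ∈ S`; it is `0` if `S` is empty. -/
noncomputable def mean [AddCommGroup F] [Module ℝ F] (S : Finset ι) (x : ι → F) : F :=
  (#S : ℝ)⁻¹ • ∑ i ∈ S, x i

lemma card_smul_mean [AddCommGroup F] [Module ℝ F] (S : Finset ι) (x : ι → F) :
    (#S : ℝ) • mean S x = ∑ i ∈ S, x i := by
  obtain rfl | hS := S.eq_empty_or_nonempty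
  · simp
  · rw [mean, smul_inv_smul₀ (by exact_mod_cast hS.card_ne_zero)]

lemma sum_sub_mean [AddCommGroup F] [Module ℝ F] (S : Finset ι) (x : ι → F) :
    ∑ i ∈ S, (x i - mean S x) = 0 := by
  rw [sum_sub_distrib, sum_const, ← Nat.cast_smul_eq_nsmul ℝ, card_smul_mean, sub_self]

lemma sum_sum_norm_sub_sq [NormedAddCommGroup F] [InnerProductSpace ℝ F] (S : Finset ι)
    (x : ι → F) :
    ∑ u ∈ S, ∑ v ∈ S, ‖x u - x v‖ ^ 2 = 2 * (#S * ∑ w ∈ S, ‖x w - mean S x‖ ^ 2) := by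
  have hdeviation (y : ι → F) (hy : ∑ w ∈ S, y w = 0) :
      ∑ u ∈ S, ∑ v ∈ S, ‖y u - y v‖ ^ 2 = 2 * (#S * ∑ w ∈ S, ‖y w‖ ^ 2) := by
    simp only [norm_sub_sq_real, sum_add_distrib, sum_sub_distrib, ← mul_sum, ← inner_sum, hy,
      inner_zero_right, sum_const, nsmul_eq_mul]
    ring
  simpa using hdeviation (fun w ↦ x w - mean S x) (sum_sub_mean S x)

end Mean

section Analysis

variable {n : ℕ} {S : Finset (Fin n)} {p : ℝ} {E : Set (Sym2 (Fin n))} {G : SimpleGraph (Fin n)}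
  {x : Fin n → EuclideanSpace ℝ (Fin n)}

lemma Admissible.adj (hG : Admissible S E G) {w v : Fin n} (hw : w ∈ S) (hv : v ∉ S)
    (h : s(w, v) ∈ E) : G.Adj w v :=
  hG.1 ((SimpleGraph.fromEdgeSet_adj E).2 ⟨h, fun hwv ↦ hv (hwv ▸ hw)⟩)

lemma sum_memInd_mul_inner_eq_zero (hG : Admissible S E G) (hx : IsFeasible G x) {v : Fin n}
    (hv : v ∉ S) : ∑ w ∈ S, memInd E s(w, v) * inner ℝ (x w) (x v) = 0 := by
  refine sum_eq_zero fun w hw ↦ ?_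
  by_cases h : s(w, v) ∈ E
  · rw [hx.inner_eq_zero w v (hG.adj hw hv h), mul_zero]
  · simp [memInd, h]

lemma sum_centred_mul_inner_sub_mean (hG : Admissible S E G) (hx : IsFeasible G x) {v : Fin n}
    (hv : v ∉ S) : ∑ w ∈ S, centred p E w v * inner ℝ (x w - mean S x) (x v) =
      (∑ w ∈ S, memInd E s(w, v)) / p * inner ℝ (mean S x) (x v) := by
  have hdeviation : ∑ w ∈ S, inner ℝ (x w - mean S x) (x v) = 0 := by
    rw [← sum_inner, sum_sub_mean, inner_zero_left]
  have hedges : ∑ w ∈ S, memInd E s(w, v) * inner ℝ (x w - mean S x) (x v) =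
      -((∑ w ∈ S, memInd E s(w, v)) * inner ℝ (mean S x) (x v)) := by
    simp only [inner_sub_left, mul_sub, sum_sub_distrib, sum_memInd_mul_inner_eq_zero hG hx hv,
      ← sum_mul, zero_sub]
  simp only [centred, sub_mul, one_mul, div_mul_eq_mul_div, sum_sub_distrib, ← sum_div, hdeviation,
    hedges]
  ring

lemma IsPseudorandom.sum_inner_le (hE : IsPseudorandom S p E) (hp : 0 < p)
    (hG : Admissible S E G) (hx : IsFeasible G x) {v : Fin n} (hv : v ∉ S) :
    ∑ w ∈ S, inner ℝ (x w) (x v) ≤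
      2 * ∑ w ∈ S, centred p E w v * inner ℝ (x w - mean S x) (x v) := by
  have hmean_nonneg : 0 ≤ inner ℝ (mean S x) (x v) := by
    rw [mean, real_inner_smul_left, sum_inner]
    exact mul_nonneg (by positivity) (sum_nonneg fun w _ ↦ hx.inner_nonneg w v)
  calc ∑ w ∈ S, inner ℝ (x w) (x v) = #S * inner ℝ (mean S x) (x v) := by
        rw [← sum_inner, ← card_smul_mean, real_inner_smul_left]
    _ ≤ 2 * ((∑ w ∈ S, memInd E s(w, v)) / p) * inner ℝ (mean S x) (x v) := by
        gcongr
        rw [← mul_div_assoc, le_div_iff₀ hp]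
        linarith [hE.1 v hv]
    _ = 2 * ∑ w ∈ S, centred p E w v * inner ℝ (x w - mean S x) (x v) := by
        rw [sum_centred_mul_inner_sub_mean hG hx hv, mul_assoc]

lemma IsPseudorandom.sum_norm_sum_centred_smul_sq_le (hE : IsPseudorandom S p E) (hp : 0 < p)
    (hx : ∀ v, ‖x v‖ = 1) :
    ∑ w ∈ S, ‖∑ v ∈ Sᶜ, centred p E w v • x v‖ ^ 2 ≤ 512 * (n : ℝ) ^ 2 / p :=
  calc ∑ w ∈ S, ‖∑ v ∈ Sᶜ, centred p E w v • x v‖ ^ 2 ≤ π / 2 * (320 * (n : ℝ) ^ 2 / p) :=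
        sum_norm_sum_smul_sq_le hE.2 fun v _ ↦ hx v
    _ ≤ 3.2 / 2 * (320 * (n : ℝ) ^ 2 / p) := by
        gcongr
        linarith [pi_lt_d2]
    _ = 512 * (n : ℝ) ^ 2 / p := by ring

lemma IsPseudorandom.sum_sum_inner_le (hE : IsPseudorandom S p E) (hp : 0 < p)
    (hG : Admissible S E G) (hx : IsFeasible G x) :
    ∑ u ∈ S, ∑ v ∈ Sᶜ, inner ℝ (x u) (x v) ≤
      2 * ∑ w ∈ S, ‖x w - mean S x‖ * ‖∑ v ∈ Sᶜ, centred p E w v • x v‖ :=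
  calc ∑ u ∈ S, ∑ v ∈ Sᶜ, inner ℝ (x u) (x v) = ∑ v ∈ Sᶜ, ∑ w ∈ S, inner ℝ (x w) (x v) := sum_comm
    _ ≤ ∑ v ∈ Sᶜ, 2 * ∑ w ∈ S, centred p E w v * inner ℝ (x w - mean S x) (x v) :=
        sum_le_sum fun v hv ↦ hE.sum_inner_le hp hG hx (mem_compl.1 hv)
    _ = 2 * ∑ w ∈ S, inner ℝ (x w - mean S x) (∑ v ∈ Sᶜ, centred p E w v • x v) := by
        rw [← mul_sum, sum_comm]
        simp only [inner_sum, real_inner_smul_right]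
    _ ≤ 2 * ∑ w ∈ S, ‖x w - mean S x‖ * ‖∑ v ∈ Sᶜ, centred p E w v • x v‖ := by
        gcongr
        exact real_inner_le_norm _ _

theorem IsPseudorandom.card_sq_mul_sum_norm_sub_mean_sq_le (hE : IsPseudorandom S p E) (hp : 0 < p)
    (hG : Admissible S E G) (hx : IsOptimal G x) :
    (#S : ℝ) ^ 2 * ∑ w ∈ S, ‖x w - mean S x‖ ^ 2 ≤ 8192 * (n : ℝ) ^ 2 / p := by
  set ζ := ∑ w ∈ S, ‖x w - mean S x‖ ^ 2
  set b : Fin n → EuclideanSpace ℝ (Fin n) := fun w ↦ ∑ v ∈ Sᶜ, centred p E w v • x v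
  set P := ∑ w ∈ S, ‖x w - mean S x‖ * ‖b w‖
  have hζ : 0 ≤ ζ := by positivity
  have hP : #S * ζ ≤ 4 * P := by
    have hspread := hx.sum_sum_norm_sub_sq_le hG.2
    rw [sum_sum_norm_sub_sq] at hspread
    linarith [hE.sum_sum_inner_le hp hG hx.1]
  have hP_sq : P ^ 2 ≤ ζ * (512 * (n : ℝ) ^ 2 / p) :=
    (sum_mul_sq_le_sq_mul_sq S _ _).trans <| mul_le_mul_of_nonneg_left
      (hE.sum_norm_sum_centred_smul_sq_le hp hx.1.norm_eq_one) hζ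
  have hsq : ζ * ((#S : ℝ) ^ 2 * ζ) ≤ ζ * (8192 * (n : ℝ) ^ 2 / p) :=
    calc ζ * ((#S : ℝ) ^ 2 * ζ) = (#S * ζ) ^ 2 := by ring
      _ ≤ (4 * P) ^ 2 := by gcongr
      _ = 16 * P ^ 2 := by ring
      _ ≤ 16 * (ζ * (512 * (n : ℝ) ^ 2 / p)) := by gcongr
      _ = ζ * (8192 * (n : ℝ) ^ 2 / p) := by ring
  obtain h | h := hζ.eq_or_lt
  · rw [← h, mul_zero]
    positivity
  · exact le_of_mul_le_mul_left hsq h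

lemma IsFeasible.one_le_dist_of_adj (hx : IsFeasible G x) {u v w : Fin n} (hwv : G.Adj w v)
    (huw : dist (x u) (x w) < 1 / 2) : 1 ≤ dist (x u) (x v) := by
  have hinner : inner ℝ (x u) (x v) ≤ dist (x u) (x w) :=
    calc inner ℝ (x u) (x v) = inner ℝ (x u - x w) (x v) := by
          rw [inner_sub_left, hx.inner_eq_zero w v hwv, sub_zero]
      _ ≤ ‖x u - x w‖ * ‖x v‖ := real_inner_le_norm _ _
      _ = dist (x u) (x w) := by rw [hx.norm_eq_one, mul_one, dist_eq_norm]
  rw [← one_le_sq_iff₀ dist_nonneg, dist_eq_norm, hx.norm_sub_sq]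
  linarith

lemma exists_norm_sub_le_of_sum_sq_le {ι F : Type*} [NormedAddCommGroup F] {S : Finset ι}
    (hS : S.Nonempty) {x : ι → F} {c : F} {r : ℝ} (hr : 0 ≤ r)
    (h : ∑ w ∈ S, ‖x w - c‖ ^ 2 ≤ #S * r ^ 2) : ∃ u ∈ S, ‖x u - c‖ ≤ r := by
  obtain ⟨u, hu, hle⟩ := exists_le_of_sum_le (g := fun _ ↦ r ^ 2) hS (by simpa using h)
  exact ⟨u, hu, (sq_le_sq₀ (norm_nonneg _) hr).1 hle⟩

lemma IsPseudorandom.exists_mem_dist_lt (hE : IsPseudorandom S p E)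
    {c : EuclideanSpace ℝ (Fin n)} (hsum : ∑ w ∈ S, ‖x w - c‖ ^ 2 ≤ p * #S / 64)
    {u v : Fin n} (hu : ‖x u - c‖ ≤ 1 / 8) (hv : v ∉ S) :
    ∃ w ∈ S, s(w, v) ∈ E ∧ dist (x u) (x w) < 1 / 2 := by
  by_contra! hfar
  have hterm (w : Fin n) (hw : w ∈ S) : memInd E s(w, v) ≤ 64 / 9 * ‖x w - c‖ ^ 2 := by
    by_cases h : s(w, v) ∈ E
    · have htriangle : dist (x u) (x w) ≤ ‖x u - c‖ + ‖x w - c‖ := by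
        simpa only [dist_eq_norm] using dist_triangle_right (x u) (x w) c
      have hfar_c : 3 / 8 ≤ ‖x w - c‖ := by linarith [hfar w hw h]
      rw [memInd, if_pos h]
      nlinarith
    · rw [memInd, if_neg h]
      positivity
  have hdegree := sum_le_sum hterm
  rw [← mul_sum] at hdegree
  have : 0 ≤ ∑ w ∈ S, ‖x w - c‖ ^ 2 := by positivity
  linarith [hE.1 v hv]

theorem IsPseudorandom.card_le_card_output (hE : IsPseudorandom S p E) (hp : 0 < p) (hp1 : p ≤ 1)
    (hcard : 524288 * (n : ℝ) ^ 2 ≤ (#S : ℝ) ^ 3 * p ^ 2) (hG : Admissible S E G)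
    (hx : IsOptimal G x) : #S ≤ #(output G x) := by
  obtain rfl | hS := S.eq_empty_or_nonempty
  · simp
  have : (0 : ℝ) < #S := by exact_mod_cast hS.card_pos
  have hsum : ∑ w ∈ S, ‖x w - mean S x‖ ^ 2 ≤ p * #S / 64 := by
    have hbound : 8192 * (n : ℝ) ^ 2 / p ≤ (#S : ℝ) ^ 2 * (p * #S / 64) := by
      rw [div_le_iff₀ hp]
      linarith
    exact le_of_mul_le_mul_left
      ((hE.card_sq_mul_sum_norm_sub_mean_sq_le hp hG hx).trans hbound) (by positivity)
  obtain ⟨u, -, hu⟩ : ∃ u ∈ S, ‖x u - mean S x‖ ≤ 1 / 8 :=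
    exists_norm_sub_le_of_sum_sq_le hS (by norm_num) (hsum.trans (by nlinarith))
  refine SemiRandom.card_le_card_output hG.2 (u := u) (fun v hdist ↦ ?_) fun v hv ↦ ?_
  · by_contra hv
    obtain ⟨w, hw, hwv, huw⟩ := hE.exists_mem_dist_lt hsum hu hv
    exact hdist.not_ge (hx.1.one_le_dist_of_adj (hG.adj hw hv hwv) huw)
  · obtain ⟨w, hw, hwv, huw⟩ := hE.exists_mem_dist_lt hsum hu hv
    exact ⟨w, by linarith, (hG.adj hw hv hwv).symm⟩

lemma pow_three_mul_sq_le {a k m q : ℝ} (ha : 0 ≤ a) (hm : 0 ≤ m) (hq : 0 < q)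
    (h : a * (m / q) ^ (2 / 3 : ℝ) ≤ k) : a ^ 3 * m ^ 2 ≤ k ^ 3 * q ^ 2 := by
  have hpow : ((m / q) ^ (2 / 3 : ℝ)) ^ 3 = (m / q) ^ 2 := by
    rw [← rpow_natCast, ← rpow_mul (by positivity), ← rpow_natCast]
    norm_num
  have hcube := pow_le_pow_left₀ (by positivity) h 3
  rw [mul_pow, hpow, div_pow, ← mul_div_assoc, div_le_iff₀ (by positivity)] at hcube
  exact hcube

lemma sqrt_le_mul_of_sq_le {k m q : ℝ} (hk : 0 ≤ k) (hkm : k ≤ m) (hq : 0 ≤ q)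
    (h : m ^ 2 ≤ k ^ 3 * q ^ 2) : √m ≤ q * k := by
  refine sqrt_le_iff.2 ⟨by positivity, ?_⟩
  obtain hm | hm := (hk.trans hkm).eq_or_lt
  · rw [← hm]
    positivity
  · refine le_of_mul_le_mul_right ?_ hm
    calc m * m ≤ (q * k) ^ 2 * k := by linarith
      _ ≤ (q * k) ^ 2 * m := by gcongr

end Analysis

end SemiRandom

theorem mainTheorem4 :
    -- the crude SDP of every graph has an optimal solution
    (∀ (n : ℕ) (G : SimpleGraph (Fin n)), ∃ x, SemiRandom.IsOptimal G x) ∧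
    -- once it is solved, the algorithm takes polynomially many steps on every input
    (∃ P : Polynomial ℕ, ∀ (n : ℕ) (G : SimpleGraph (Fin n))
      (x : Fin n → EuclideanSpace ℝ (Fin n)), (SemiRandom.recover G x).steps ≤ P.eval n) ∧
    -- with high probability, whatever the adversary does, it finds an independent set of size `≥ k`
    (∃ c : ℝ, 0 < c ∧ ∀ ε : ℝ, 0 < ε → ∃ N : ℕ, ∀ n : ℕ, N ≤ n →
      ∀ p : unitInterval, 0 < p → ∀ (k : ℕ) (S : Finset (Fin n)), S.card = k →
        c * ((n : ℝ) / (p : ℝ)) ^ (2 / 3 : ℝ) ≤ (k : ℝ) →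
        1 - ε ≤ (SemiRandom.boundaryLaw S p).real
          {E' | ∀ G : SimpleGraph (Fin n), SemiRandom.Admissible S E' G →
            ∀ x, SemiRandom.IsOptimal G x →
              G.IsIndepSet (SemiRandom.output G x : Set (Fin n)) ∧
              k ≤ (SemiRandom.output G x).card}) := by
  refine ⟨fun n G ↦ SemiRandom.exists_isOptimal G,
    ⟨.X * (21 * .X ^ 2 + 14 * .X + 5) + 1, fun n G x ↦ ?_⟩, 81, by norm_num, fun ε hε ↦ ?_⟩
  · simpa using SemiRandom.steps_recover_le G x
  obtain ⟨N, hN⟩ := SemiRandom.exists_forall_le_measureReal_isPseudorandom hε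
  refine ⟨N, fun n hn p hp k S hS hk ↦ ?_⟩
  subst hS
  have hp' : (0 : ℝ) < p := hp
  have hcube := SemiRandom.pow_three_mul_sq_le (by norm_num) n.cast_nonneg hp' hk
  have hsqrt : √n ≤ p * S.card := SemiRandom.sqrt_le_mul_of_sq_le (Nat.cast_nonneg _)
    (SemiRandom.card_le_card_fin S) hp'.le (by nlinarith)
  refine (hN n hn p S hp hsqrt).trans (MeasureTheory.measureReal_mono fun E hE G hG x hx ↦ ?_)
  exact ⟨SemiRandom.isIndepSet_output G x,
    hE.card_le_card_output hp' p.2.2 (by nlinarith) hG hx⟩
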